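/- **Setting.** Let $n\ge 1$ and let $\mathcal C$ be a quantum channel (completely positive trace-preserving map) with input wires $A_1,\dots,A_n$ and output wires $B_1,\dots,B_n$ of finite dimensions $d_{A_i},d_{B_j}\ge 1$. Let $C=\frac{1}{\prod_i d_{A_i}}\sum_{f,f'}|f\rangle\langle f'|\otimes\mathcal C(|f\rangle\langle f'|)$ be its Choi state and $C_{A_i,B_j}$ its marginal on $A_i,B_j$. For an operator $\rho$ on $A\otimes B$ put $\chi_1(\rho)=\|\rho-\rho_A\otimes\rho_B\|_1$, with $\rho_A,\rho_B$ the partial traces and $\|X\|_1=\mathrm{Tr}\sqrt{X^\dagger X}$. Write $\mathcal C\in\mathrm{Comb}[(A_{\sigma(1)},B_{\pi(1)}),\dots,(A_{\sigma(n)},B_{\pi(n)})]$ if $\mathcal C$ is a concatenation of $n$ channels with memory (teeth), the $k$-th with input $A_{\sigma(k)}$ and output $B_{\pi(k)}$. A POVM $\{P_\alpha\}$ on a $d$-dimensional space is a minimal informationally complete POVM if it has $d^2$ elements, linearly independent and spanning all operators; its frame operator is $\sum_\alpha|P_\alpha\rangle\!\rangle\langle\!\langle P_\alpha|$ with $|P_\alpha\rangle\!\rangle=\sum_{r,s}(P_\alpha)_{rs}|r\rangle|s\rangle$.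 Let such POVMs $\{P^i_\alpha\}$ for each $A_i$ and $\{Q^j_\beta\}$ for each $B_j$ be given, let $\lambda_{\min}$ be the least eigenvalue of all their frame operators, $d_A=\max_i d_{A_i}$ and $d_B=\max_j d_{B_j}$. **Algorithm** (input: black-box access to $\mathcal C$, a number $N$, a number $\chi_{\min}>0$). 1. For $k=1,\dots,N$ draw independent $a^{(k)}_i$, $i=1,\dots,n$, with $\Pr[a_i^{(k)}=\alpha]=\mathrm{Tr}[P^i_\alpha]/d_{A_i}$; apply $\mathcal C$ to $\bigotimes_i\psi^i_{a^{(k)}_i}$, where $\psi^i_\alpha=(P^i_\alpha)^T/\mathrm{Tr}[P^i_\alpha]$, and measure each $B_j$ with $\{Q^j_\beta\}$, with outcome $b^{(k)}_j$. 2. For all $i,j$ let $\hat p_{\alpha\beta}$ be the empirical frequencies of $(a_i^{(k)},b_j^{(k)})_{k\le N}$ and let $\hat\rho$ be given by $|\hat\rho\rangle\!\rangle=(F^{-1}S^\dagger\otimes G^{-1}R^\dagger)|\hat p\rangle$, where $S=\sum_\alpha|\alpha\rangle\langle\!\langle P^i_\alpha|$, $R=\sum_\beta|\beta\rangle\langle\!\langle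 Q^j_\beta|$, $F=S^\dagger S$, $G=R^\dagger R$. Declare $A_i,B_j$ independent if $\chi_1(\hat\rho)\le\chi_{\min}/2$ and correlated otherwise. 3. Let $c_A(i)$ be the number of outputs declared correlated with $A_i$ and $c_B(j)$ the number of inputs declared correlated with $B_j$. Sort the inputs in descending order of $c_A$ and the outputs in ascending order of $c_B$, and output the two sorted lists paired entry by entry. **Cost model.** Preparing a state of a $d$-dimensional system takes time $O(d)$ and a measurement with $m$ outcomes takes time $O(m^2)$; a use of $\mathcal C$, an arithmetic operation on numbers, a comparison and a step of control take time $O(1)$; sampling from a known distribution with $m$ outcomes takes $O(1+\log m)$ and the singular values of an $m\times m$ matrix take $O(m^3)$. The POVMs and the inverses of their frame operators are computed in advance. **Theorem.** There are universal constants $c_1,c_2,c_3>0$ such that the following holds. Let $\mathcal C\in\mathrm{Comb}[(A_{\sigma(1)},B_{\pi(1)}),\dots,(A_{\sigma(n)},B_{\pi(n)})]$ for permutations $\sigma,\pi$, let $\chi_{\min}>0$, and suppose that for all $i,j$: if $j<i$, then $A_{\sigma(i)}$ and $B_{\pi(j)}$ are independent, $\chi_1(C_{A_{\sigma(i)},B_{\pi(j)}})=0$;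 if $j\ge i$, then $\chi_1(C_{A_{\sigma(i)},B_{\pi(j)}})\ge\chi_{\min}$. Let $0<\kappa<1$ and $$X=d_A^4\,d_B^4\,\lambda_{\min}^{-2}\,\chi_{\min}^{-2}\,\log\!\big(n\,d_A\,d_B\,\kappa^{-1}\big).$$ Then $\lceil c_1X\rceil\le c_2X$, and for every integer $N\ge\lceil c_1X\rceil$ the algorithm outputs the correct causal order $(A_{\sigma(1)},B_{\pi(1)}),\dots,(A_{\sigma(n)},B_{\pi(n)})$ with probability at least $1-\kappa$, and every run uses $\mathcal C$ exactly $N$ times and takes time at most $c_3\,N\,n\,(n+d_A+d_B^4)$. In particular $N=O(X)$ queries and running time $O(Nn(n+d_A+d_B^4))$ suffice. -/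

import Mathlib

open scoped Matrix Kronecker ComplexOrder

noncomputable section

namespace CausalOrder

/-! ### Matrices, trace norm, channels -/

/-- The computational basis of the joint system `⨂ i, ℂ^(d i)`. -/
abbrev Joint {n : ℕ} (d : Fin n → ℕ) : Type := (i : Fin n) → Fin (d i)

/-- The tensor product `⨂ i, X i` as a matrix on the joint system. -/
def tensorOp {n : ℕ} {d : Fin n → ℕ} (X : ∀ i, Matrix (Fin (d i)) (Fin (d i)) ℂ) :
    Matrix (Joint d) (Joint d) ℂ :=
  Matrix.of fun f g => ∏ i, X i (f i) (g i)

/-- The Schatten 1-norm `Tr √(X† X)`: the sum of the square roots of the eigenvalues of `X† X`. -/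
def traceNorm {ι : Type} [Fintype ι] [DecidableEq ι] (X : Matrix ι ι ℂ) : ℝ :=
  ∑ i, Real.sqrt ((Matrix.isHermitian_conjTranspose_mul_self X).eigenvalues i)

/-- `id_r ⊗ Φ`, applied blockwise. -/
def ampliate {a b : Type} (r : ℕ) (Φ : Matrix a a ℂ →ₗ[ℂ] Matrix b b ℂ)
    (X : Matrix (Fin r × a) (Fin r × a) ℂ) : Matrix (Fin r × b) (Fin r × b) ℂ :=
  Matrix.of fun p q => Φ (Matrix.of fun s t => X (p.1, s) (q.1, t)) p.2 q.2

/-- A quantum channel: a completely positive trace-preserving linear map. -/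
structure Channel (a b : Type) [Fintype a] [Fintype b] where
  map : Matrix a a ℂ →ₗ[ℂ] Matrix b b ℂ
  trace_map : ∀ X, (map X).trace = X.trace
  completelyPositive : ∀ (r : ℕ) (X : Matrix (Fin r × a) (Fin r × a) ℂ),
    X.PosSemidef → (ampliate r map X).PosSemidef

/-- A density operator on `ℂ^d`. -/
structure DensityOp (d : ℕ) where
  mat : Matrix (Fin d) (Fin d) ℂ
  posSemidef : mat.PosSemidef
  trace_eq_one : mat.trace = 1

/-- A POVM on `ℂ^d` with `m` outcomes. -/
structure POVM (d m : ℕ) where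
  elem : Fin m → Matrix (Fin d) (Fin d) ℂ
  posSemidef : ∀ α, (elem α).PosSemidef
  sum_eq_one : ∑ α, elem α = 1

/-- A linearly independent informationally complete POVM on `ℂ^d`, with `d ^ 2` elements. -/
structure ICPOVM (d : ℕ) extends POVM d (d ^ 2) where
  span_eq_top : Submodule.span ℂ (Set.range elem) = ⊤
  linearIndependent : LinearIndependent ℂ elem

/-! ### Frame operator -/

/-- The vectorization `|X⟫ = ∑ i j, X i j |i⟩|j⟩`. -/
def vectorize {d : ℕ} (X : Matrix (Fin d) (Fin d) ℂ) : Fin d × Fin d → ℂ := fun p => X p.1 p.2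

/-- The frame operator `∑ α, |P α⟫⟪P α|`. -/
def frameOp {d m : ℕ} (P : POVM d m) : Matrix (Fin d × Fin d) (Fin d × Fin d) ℂ :=
  ∑ α, Matrix.vecMulVec (vectorize (P.elem α)) (star (vectorize (P.elem α)))

theorem frameOp_isHermitian {d m : ℕ} (P : POVM d m) : (frameOp P).IsHermitian := by
  unfold frameOp Matrix.IsHermitian
  rw [Matrix.conjTranspose_sum]
  refine Finset.sum_congr rfl fun α _ => ?_
  ext p q
  simp [Matrix.vecMulVec_apply, mul_comm]

/-- The minimum eigenvalue of the frame operator. -/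
def frameLambdaMin {d m : ℕ} (P : POVM d m) : ℝ := ⨅ p, (frameOp_isHermitian P).eigenvalues p

/-! ### Choi state, its marginals, and the correlation measure -/

/-- The Choi state `(1/d) ∑ f f', |f⟩⟨f'| ⊗ C(|f⟩⟨f'|)`. -/
def choi {a b : Type} [Fintype a] [DecidableEq a] [Fintype b] (C : Channel a b) :
    Matrix (a × b) (a × b) ℂ :=
  Matrix.of fun p q => (Fintype.card a : ℂ)⁻¹ * C.map (Matrix.single p.1 q.1 1) p.2 q.2

/-- The marginal of the Choi state on the input wire `A_i` and the output wire `B_j`: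
all the other wires are traced out. -/
def choiMarginal {n : ℕ} {dA dB : Fin n → ℕ} (C : Channel (Joint dA) (Joint dB)) (i j : Fin n) :
    Matrix (Fin (dA i) × Fin (dB j)) (Fin (dA i) × Fin (dB j)) ℂ :=
  Matrix.of fun p q => ∑ f : Joint dA, ∑ g : Joint dB,
    if f i = p.1 ∧ g j = p.2 then
      choi C (f, g) (Function.update f i q.1, Function.update g j q.2)
    else 0

/-- The partial trace over the second system. -/
def traceRight {a b : Type} [Fintype b] (ρ : Matrix (a × b) (a × b) ℂ) : Matrix a a ℂ :=
  Matrix.of fun x x' => ∑ y, ρ (x, y) (x', y)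

/-- The partial trace over the first system. -/
def traceLeft {a b : Type} [Fintype a] (ρ : Matrix (a × b) (a × b) ℂ) : Matrix b b ℂ :=
  Matrix.of fun y y' => ∑ x, ρ (x, y) (x, y')

/-- `χ₁(ρ) = ‖ρ_AB - ρ_A ⊗ ρ_B‖₁`. -/
def chiOne {a b : Type} [Fintype a] [DecidableEq a] [Fintype b] [DecidableEq b]
    (ρ : Matrix (a × b) (a × b) ℂ) : ℝ :=
  traceNorm (ρ - traceRight ρ ⊗ₖ traceLeft ρ)

/-! ### Quantum combs and the assumption on correlations -/

/-- `C ∈ Comb[(A_{σ 1}, B_{π 1}), …, (A_{σ n}, B_{π n})]`: there are memory systems `M_0, …, M_n`,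
the first and the last one trivial, and channels `T k : A_{σ k} ⊗ M_k → B_{π k} ⊗ M_{k+1}` whose
concatenation through the memories is `C`; the concatenation is written in matrix elements, as a
sum over the basis labels `μ` (ket side) and `μ'` (bra side) of the memories. -/
def IsComb {n : ℕ} {dA dB : Fin n → ℕ} (C : Channel (Joint dA) (Joint dB))
    (σ π : Equiv.Perm (Fin n)) : Prop :=
  ∃ dM : Fin (n + 1) → ℕ, dM 0 = 1 ∧ dM (Fin.last n) = 1 ∧
    ∃ T : ∀ k : Fin n, Channel (Fin (dA (σ k)) × Fin (dM k.castSucc))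
        (Fin (dB (π k)) × Fin (dM k.succ)),
      ∀ (f f' : Joint dA) (g g' : Joint dB),
        C.map (Matrix.single f f' 1) g g' =
          ∑ μ : Joint dM, ∑ μ' : Joint dM, ∏ k : Fin n,
            (T k).map
              (Matrix.single (f (σ k), μ k.castSucc) (f' (σ k), μ' k.castSucc) 1)
              (g (π k), μ k.succ) (g' (π k), μ' k.succ)

/-- Inputs are independent of the outputs of strictly earlier teeth, and are correlated, with
`χ₁ ≥ χmin`, with every output of the same tooth or of a later one. -/
def TotallyCorrelated {n : ℕ} {dA dB : Fin n → ℕ} (C : Channel (Joint dA) (Joint dB))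
    (σ π : Equiv.Perm (Fin n)) (χmin : ℝ) : Prop :=
  ∀ i j : Fin n,
    (j < i → chiOne (choiMarginal C (σ i) (π j)) = 0) ∧
    (i ≤ j → χmin ≤ chiOne (choiMarginal C (σ i) (π j)))

/-! ### Born rule for product preparations and product measurements -/

theorem tensorOp_mul {n : ℕ} {d : Fin n → ℕ} (X Y : ∀ i, Matrix (Fin (d i)) (Fin (d i)) ℂ) :
    tensorOp (fun i => X i * Y i) = tensorOp X * tensorOp Y := by
  ext f g
  simp only [tensorOp, Matrix.of_apply, Matrix.mul_apply, ← Finset.prod_mul_distrib]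
  rw [Finset.prod_univ_sum]
  simp

theorem tensorOp_conjTranspose {n : ℕ} {d : Fin n → ℕ}
    (X : ∀ i, Matrix (Fin (d i)) (Fin (d i)) ℂ) :
    tensorOp (fun i => (X i)ᴴ) = (tensorOp X)ᴴ := by
  ext f g
  simp [tensorOp, Matrix.conjTranspose_apply]

theorem exists_conjTranspose_mul_self {ι : Type} [Fintype ι] {A : Matrix ι ι ℂ}
    (h : A.PosSemidef) : ∃ B : Matrix ι ι ℂ, A = Bᴴ * B := by
  classical
  open scoped MatrixOrder in
  obtain ⟨B, hB⟩ := CStarAlgebra.nonneg_iff_eq_star_mul_self.mp h.nonneg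
  exact ⟨B, hB⟩

theorem tensorOp_posSemidef {n : ℕ} {d : Fin n → ℕ} {X : ∀ i, Matrix (Fin (d i)) (Fin (d i)) ℂ}
    (h : ∀ i, (X i).PosSemidef) : (tensorOp X).PosSemidef := by
  choose B hB using fun i => exists_conjTranspose_mul_self (h i)
  have : tensorOp X = (tensorOp B)ᴴ * tensorOp B := by
    rw [← tensorOp_conjTranspose, ← tensorOp_mul]
    congr 1
    funext i
    exact hB i
  rw [this]
  exact Matrix.posSemidef_conjTranspose_mul_self _

theorem trace_tensorOp {n : ℕ} {d : Fin n → ℕ} (X : ∀ i, Matrix (Fin (d i)) (Fin (d i)) ℂ) :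
    (tensorOp X).trace = ∏ i, (X i).trace := by
  simp only [Matrix.trace, tensorOp, Matrix.diag_apply, Matrix.of_apply]
  rw [Finset.prod_univ_sum]
  simp

theorem sum_tensorOp {n : ℕ} {d m : Fin n → ℕ}
    (X : ∀ j, Fin (m j) → Matrix (Fin (d j)) (Fin (d j)) ℂ) :
    ∑ b : Joint m, tensorOp (fun j => X j (b j)) = tensorOp (fun j => ∑ β, X j β) := by
  ext f g
  simp only [tensorOp, Matrix.of_apply, Matrix.sum_apply]
  rw [Finset.prod_univ_sum]
  simp

theorem tensorOp_one {n : ℕ} {d : Fin n → ℕ} :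
    tensorOp (fun i : Fin n => (1 : Matrix (Fin (d i)) (Fin (d i)) ℂ)) = 1 := by
  ext f g
  simp only [tensorOp, Matrix.of_apply, Matrix.one_apply]
  by_cases h : f = g
  · simp [h]
  · obtain ⟨i, hi⟩ := Function.ne_iff.mp h
    rw [if_neg h]
    exact Finset.prod_eq_zero (Finset.mem_univ i) (if_neg hi)

theorem Channel.map_posSemidef {a b : Type} [Fintype a] [Fintype b] (C : Channel a b)
    {X : Matrix a a ℂ} (h : X.PosSemidef) : (C.map X).PosSemidef := by
  have h1 : (X.submatrix (Prod.snd : Fin 1 × a → a) Prod.snd).PosSemidef := h.submatrix _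
  exact (C.completelyPositive 1 _ h1).submatrix (fun y => ((0 : Fin 1), y))

theorem trace_mul_re_nonneg {ι : Type} [Fintype ι] {A B : Matrix ι ι ℂ}
    (hA : A.PosSemidef) (hB : B.PosSemidef) : 0 ≤ (A * B).trace.re := by
  obtain ⟨R, rfl⟩ := exists_conjTranspose_mul_self hA
  rw [Matrix.mul_assoc, Matrix.trace_mul_comm]
  exact (Complex.le_def.mp (hB.mul_mul_conjTranspose_same R).trace_nonneg).1

/-- The Born probability `Tr[(⨂ j, M j (b j)) C(⨂ i, ρ i)]`. -/
def bornWeight {n : ℕ} {dA dB m : Fin n → ℕ} (C : Channel (Joint dA) (Joint dB))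
    (ρ : ∀ i, DensityOp (dA i)) (M : ∀ j, POVM (dB j) (m j)) (b : Joint m) : ℝ :=
  (tensorOp (fun j => (M j).elem (b j)) * C.map (tensorOp fun i => (ρ i).mat)).trace.re

theorem sum_bornWeight {n : ℕ} {dA dB m : Fin n → ℕ} (C : Channel (Joint dA) (Joint dB))
    (ρ : ∀ i, DensityOp (dA i)) (M : ∀ j, POVM (dB j) (m j)) :
    ∑ b, ENNReal.ofReal (bornWeight C ρ M b) = 1 := by
  have hpos : ∀ b, 0 ≤ bornWeight C ρ M b := fun b =>
    trace_mul_re_nonneg (tensorOp_posSemidef fun j => (M j).posSemidef _)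
      (C.map_posSemidef (tensorOp_posSemidef fun i => (ρ i).posSemidef))
  rw [← ENNReal.ofReal_sum_of_nonneg fun b _ => hpos b]
  have : ∑ b, bornWeight C ρ M b = 1 := by
    simp only [bornWeight]
    rw [← Complex.re_sum, ← Matrix.trace_sum, ← Finset.sum_mul,
      sum_tensorOp fun j β => (M j).elem β]
    simp only [POVM.sum_eq_one]
    rw [tensorOp_one, one_mul, C.trace_map, trace_tensorOp]
    simp [DensityOp.trace_eq_one]
  rw [this, ENNReal.ofReal_one]

/-- The joint distribution of the outcomes of measuring, for all `j`, the POVM `M j` on the output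
`B_j` of the channel `C` applied to the product state `⨂ i, ρ i`. -/
def born {n : ℕ} {dA dB m : Fin n → ℕ} (C : Channel (Joint dA) (Joint dB))
    (ρ : ∀ i, DensityOp (dA i)) (M : ∀ j, POVM (dB j) (m j)) : PMF (Joint m) :=
  PMF.ofFintype (fun b => ENNReal.ofReal (bornWeight C ρ M b)) (sum_bornWeight C ρ M)

/-! ### The input ensemble of an informationally complete POVM -/

theorem ICPOVM.trace_ne_zero {d : ℕ} (P : ICPOVM d) (α : Fin (d ^ 2)) :
    (P.elem α).trace ≠ 0 := fun h =>
  P.linearIndependent.ne_zero α ((P.posSemidef α).trace_eq_zero_iff.mp h)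

theorem POVM.trace_nonneg {d m : ℕ} (P : POVM d m) (α : Fin m) :
    0 ≤ (P.elem α).trace.re ∧ (((P.elem α).trace.re : ℝ) : ℂ) = (P.elem α).trace := by
  have h := Complex.le_def.mp (P.posSemidef α).trace_nonneg
  exact ⟨h.1, Complex.ext rfl (by simpa using h.2)⟩

/-- The state `ψ_α = (P_α)ᵀ / Tr[P_α]`. -/
def ICPOVM.state {d : ℕ} (P : ICPOVM d) (α : Fin (d ^ 2)) : DensityOp d where
  mat := (P.elem α).trace⁻¹ • (P.elem α)ᵀ
  posSemidef := by
    obtain ⟨h0, h1⟩ := P.toPOVM.trace_nonneg α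
    have h2 : (0 : ℝ) ≤ ((P.elem α).trace.re)⁻¹ := inv_nonneg.mpr h0
    have h3 := (P.posSemidef α).transpose.smul h2
    have h4 : (P.elem α).trace⁻¹ • (P.elem α)ᵀ = ((P.elem α).trace.re)⁻¹ • (P.elem α)ᵀ := by
      rw [← Complex.coe_smul, Complex.ofReal_inv, h1]
    rw [h4]
    exact h3
  trace_eq_one := by
    rw [Matrix.trace_smul, Matrix.trace_transpose, smul_eq_mul, inv_mul_cancel₀ (P.trace_ne_zero α)]

/-- The distribution `Pr[α] = Tr[P_α] / d`. -/
def POVM.inputDist {d m : ℕ} [NeZero d] (P : POVM d m) : PMF (Fin m) :=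
  PMF.ofFintype (fun α => ENNReal.ofReal ((P.elem α).trace.re / d)) (by
    have hd : (d : ℝ) ≠ 0 := Nat.cast_ne_zero.mpr (NeZero.ne d)
    rw [← ENNReal.ofReal_sum_of_nonneg fun α _ =>
      div_nonneg (P.trace_nonneg α).1 (Nat.cast_nonneg d)]
    rw [← Finset.sum_div, ← Complex.re_sum, ← Matrix.trace_sum, P.sum_eq_one, Matrix.trace_one]
    simp [hd])

/-! ### Programs with black-box access to a channel, their running time and their queries

A program handles classical data by the instructions below, each with its cost; fetching operands
from and storing results in a random access memory is part of an instruction, and `tick` is the unit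
of control (one iteration of a loop, one branch, one memory update). The quantum costs are `d` for
preparing a state of `ℂ^d` and `m ^ 2` for a measurement with `m` outcomes. Programs see the
unknown channel only through `query`. -/

/-- Classical instructions, indexed by the type of the result. -/
inductive Instr : Type → Type
  | tick : Instr Unit
  | add (x y : ℂ) : Instr ℂ
  | sub (x y : ℂ) : Instr ℂ
  | mul (x y : ℂ) : Instr ℂ
  | div (x y : ℂ) : Instr ℂ
  | leReal (x y : ℝ) : Instr Bool
  | leNat (x y : ℕ) : Instr Bool
  | succNat (x : ℕ) : Instr ℕ
  | traceNorm {a b : ℕ} (X : Matrix (Fin a × Fin b) (Fin a × Fin b) ℂ) : Instr ℝ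

open Classical in
/-- The result of an instruction. -/
def Instr.eval : {β : Type} → Instr β → β
  | _, .tick => ()
  | _, .add x y => x + y
  | _, .sub x y => x - y
  | _, .mul x y => x * y
  | _, .div x y => x / y
  | _, .leReal x y => decide (x ≤ y)
  | _, .leNat x y => decide (x ≤ y)
  | _, .succNat x => x + 1
  | _, .traceNorm X => CausalOrder.traceNorm X

/-- The cost of an instruction: one for elementary operations, and the cube of the size for the
singular values of a matrix. -/
def Instr.cost : {β : Type} → Instr β → ℕ
  | _, .traceNorm (a := a) (b := b) _ => (a * b) ^ 3
  | _, _ => 1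

/-- Programs with result in `α`. `draw p` samples from the distribution `p`, known beforehand;
`query ρ M` prepares the input `A_i` in the state `ρ i` for every `i`, uses the unknown channel
once, measures the output `B_j` with the POVM `M j` for every `j`, and returns the outcomes. -/
inductive Prog {n : ℕ} (dA dB : Fin n → ℕ) (α : Type) : Type 1
  | ret (x : α) : Prog dA dB α
  | instr {β : Type} (i : Instr β) (k : β → Prog dA dB α) : Prog dA dB α
  | draw {m : ℕ} (p : PMF (Fin m)) (k : Fin m → Prog dA dB α) : Prog dA dB α
  | query {m : Fin n → ℕ} (ρ : ∀ i, DensityOp (dA i)) (M : ∀ j, POVM (dB j) (m j))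
      (k : Joint m → Prog dA dB α) : Prog dA dB α

/-- The outcome of a run: the value returned, the time spent, the number of uses of the channel. -/
structure Outcome (α : Type) where
  value : α
  time : ℕ
  queries : ℕ

/-- Add a cost to an outcome. -/
def Outcome.charge {α : Type} (t q : ℕ) (r : Outcome α) : Outcome α :=
  ⟨r.value, t + r.time, q + r.queries⟩

section Programs

variable {n : ℕ} {dA dB : Fin n → ℕ}

/-- Sequential composition. -/
def Prog.bind {α β : Type} : Prog dA dB α → (α → Prog dA dB β) → Prog dA dB β
  | .ret x, f => f x
  | .instr i k, f => .instr i fun y => (k y).bind f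
  | .draw p k, f => .draw p fun y => (k y).bind f
  | .query ρ M k, f => .query ρ M fun y => (k y).bind f

instance : Monad (Prog dA dB) where
  pure := Prog.ret
  bind := Prog.bind

/-- The distribution of the outcomes of a program that is run on the channel `C`. Sampling from a
distribution with `m` outcomes costs `log₂ m + 1` (a search in its cumulative table). -/
def Prog.run (C : Channel (Joint dA) (Joint dB)) {α : Type} : Prog dA dB α → PMF (Outcome α)
  | .ret x => PMF.pure ⟨x, 0, 0⟩
  | .instr i k => ((k i.eval).run C).map (Outcome.charge i.cost 0)
  | .draw (m := m) p k =>
      (p.bind fun x => (k x).run C).map (Outcome.charge (Nat.log 2 m + 1) 0)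
  | .query (m := m) ρ M k =>
      ((born C ρ M).bind fun b => (k b).run C).map
        (Outcome.charge ((∑ i, dA i) + 1 + ∑ j, m j ^ 2) 1)

/-- Execute one instruction. -/
def exec {β : Type} (i : Instr β) : Prog dA dB β := .instr i .ret

/-- Sample from a known distribution. -/
def drawFrom {m : ℕ} (p : PMF (Fin m)) : Prog dA dB (Fin m) := .draw p .ret

/-- Use the channel once. -/
def useChannel {m : Fin n → ℕ} (ρ : ∀ i, DensityOp (dA i)) (M : ∀ j, POVM (dB j) (m j)) :
    Prog dA dB (Joint m) := .query ρ M .ret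

/-- `for x in l`, updating a state. -/
def loop {ι β : Type} (l : List ι) (init : β) (body : β → ι → Prog dA dB β) : Prog dA dB β :=
  match l with
  | [] => pure init
  | x :: l => do
      exec .tick
      let s ← body init x
      loop l s body

/-- `for i in 0, …, m - 1`, collecting the results in an array. -/
def forEach : {m : ℕ} → {β : Fin m → Type} → ((i : Fin m) → Prog dA dB (β i)) →
    Prog dA dB ((i : Fin m) → β i)
  | 0, _, _ => pure fun i => i.elim0
  | _ + 1, β, body => do
      exec .tick
      let x ← body 0
      let xs ← forEach (β := fun i => β i.succ) fun i => body i.succ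
      pure (Fin.cons x xs)

/-- The sum of `m` numbers. -/
def sumOver {m : ℕ} (term : Fin m → Prog dA dB ℂ) : Prog dA dB ℂ :=
  loop (List.finRange m) 0 fun s i => do
    let t ← term i
    exec (.add s t)

/-- The empirical frequencies `p̂_{αβ}` of `N` pairs of outcomes. -/
def frequencies {N m m' : ℕ} (data : Fin N → Fin m × Fin m') :
    Prog dA dB (Fin m → Fin m' → ℂ) := do
  let zero ← forEach fun _ : Fin m => forEach fun _ : Fin m' => pure (0 : ℂ)
  let w ← exec (.div 1 (N : ℂ))
  loop (List.finRange N) zero fun p k => do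
    let x ← exec (.add (p (data k).1 (data k).2) w)
    pure (Function.update p (data k).1 (Function.update (p (data k).1) (data k).2 x))

/-- The operator `ρ̂_AB` with `|ρ̂_AB⟫ = (F⁻¹ S† ⊗ G⁻¹ R†) |p̂⟫`, where `S† = ∑ α, |P α⟫⟨α|`,
`R† = ∑ β, |Q β⟫⟨β|`, and `F`, `G` are the frame operators. The POVMs and the inverses of their
frame operators are known before the execution. -/
def reconstruct {a b : ℕ} (P : ICPOVM a) (Q : ICPOVM b)
    (p : Fin (a ^ 2) → Fin (b ^ 2) → ℂ) :
    Prog dA dB (Matrix (Fin a × Fin b) (Fin a × Fin b) ℂ) := do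
  -- `w = (S† ⊗ R†) |p̂⟫`, with indices `x x' y y'`
  let w ← forEach fun x : Fin a => forEach fun x' : Fin a =>
    forEach fun y : Fin b => forEach fun y' : Fin b =>
      sumOver fun α : Fin (a ^ 2) => sumOver fun β : Fin (b ^ 2) => do
        let t ← exec (.mul (vectorize (P.elem α) (x, x')) (vectorize (Q.elem β) (y, y')))
        exec (.mul t (p α β))
  -- `r = (F⁻¹ ⊗ G⁻¹) w`
  let r ← forEach fun x : Fin a => forEach fun x' : Fin a =>
    forEach fun y : Fin b => forEach fun y' : Fin b =>
      sumOver fun u : Fin a => sumOver fun u' : Fin a =>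
        sumOver fun v : Fin b => sumOver fun v' : Fin b => do
          let t ← exec (.mul ((frameOp P.toPOVM)⁻¹ (x, x') (u, u'))
            ((frameOp Q.toPOVM)⁻¹ (y, y') (v, v')))
          exec (.mul t (w u u' v v'))
  pure (Matrix.of fun s t => r s.1 t.1 s.2 t.2)

/-- Computation of `χ₁(ρ)`. -/
def computeChiOne {a b : ℕ} (ρ : Matrix (Fin a × Fin b) (Fin a × Fin b) ℂ) : Prog dA dB ℝ := do
  let ρA ← forEach fun x : Fin a => forEach fun x' : Fin a =>
    sumOver fun y : Fin b => pure (ρ (x, y) (x', y))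
  let ρB ← forEach fun y : Fin b => forEach fun y' : Fin b =>
    sumOver fun x : Fin a => pure (ρ (x, y) (x, y'))
  let τ ← forEach fun x : Fin a => forEach fun y : Fin b =>
    forEach fun x' : Fin a => forEach fun y' : Fin b => do
      let t ← exec (.mul (ρA x x') (ρB y y'))
      exec (.sub (ρ (x, y) (x', y')) t)
  exec (.traceNorm (Matrix.of fun s t => τ s.1 s.2 t.1 t.2 :
    Matrix (Fin a × Fin b) (Fin a × Fin b) ℂ))

/-- Estimation of `χ₁` of a bipartite state from `N` outcomes of the POVM `{P α ⊗ Q β}`. -/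
def estimateChiOne {N a b : ℕ} (P : ICPOVM a) (Q : ICPOVM b)
    (data : Fin N → Fin (a ^ 2) × Fin (b ^ 2)) : Prog dA dB ℝ := do
  let p ← frequencies data
  let ρ ← reconstruct P Q p
  computeChiOne ρ

/-- Independence tests of all pairs of an input and an output wire: `ind i j = true` indicates that
`A_i` and `B_j` are independent. The same `N` uses of the channel serve all pairs. -/
def independence [∀ i, NeZero (dA i)] (P : ∀ i, ICPOVM (dA i)) (Q : ∀ j, ICPOVM (dB j))
    (N : ℕ) (threshold : ℝ) : Prog dA dB (Fin n → Fin n → Bool) := do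
  let a ← forEach fun _ : Fin N => forEach fun i : Fin n => drawFrom (P i).inputDist
  let b ← forEach fun k : Fin N =>
    useChannel (fun i => (P i).state (a k i)) fun j => (Q j).toPOVM
  forEach fun i : Fin n => forEach fun j : Fin n => do
    let χ ← estimateChiOne (P i) (Q j) fun k => (a k i, b k j)
    exec (.leReal χ threshold)

/-- The number of entries `false` of an array. -/
def countFalse {m : ℕ} (v : Fin m → Bool) : Prog dA dB ℕ :=
  loop (List.finRange m) 0 fun c i => if v i then pure c else exec (.succNat c)

/-- Insertion into a list that is sorted for the comparison `before`. -/
def insertSorted {ι : Type} (before : ι → ι → Prog dA dB Bool) (x : ι) :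
    List ι → Prog dA dB (List ι)
  | [] => do
      exec .tick
      pure [x]
  | y :: l => do
      exec .tick
      let c ← before x y
      if c then
        pure (x :: y :: l)
      else do
        let l' ← insertSorted before x l
        pure (y :: l')

/-- Insertion sort. -/
def sortList {ι : Type} (before : ι → ι → Prog dA dB Bool) : List ι → Prog dA dB (List ι)
  | [] => pure []
  | x :: l => do
      exec .tick
      let l' ← sortList before l
      insertSorted before x l'

/-- Pair two lists entry by entry. -/
def pairUp {ι : Type} : List ι → List ι → Prog dA dB (List (ι × ι))
  | x :: l, y :: l' => do
      exec .tick
      let r ← pairUp l l'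
      pure ((x, y) :: r)
  | _, _ => pure []

/-- The causal order discovery algorithm: test all pairs of an input and an output with threshold
`χmin / 2`, count the correlations of every wire, sort the inputs in descending and the outputs in
ascending order of the counts. An entry `(i, j)` at position `k` of the result says that the `k`-th
tooth has input `A_i` and output `B_j`. -/
def discoverOrder [∀ i, NeZero (dA i)] (P : ∀ i, ICPOVM (dA i)) (Q : ∀ j, ICPOVM (dB j))
    (N : ℕ) (χmin : ℝ) : Prog dA dB (List (Fin n × Fin n)) := do
  let ind ← independence P Q N (χmin / 2)
  let cA ← forEach fun k : Fin n => countFalse fun i => ind k i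
  let cB ← forEach fun k : Fin n => countFalse fun i => ind i k
  let inputs ← sortList (fun x y => exec (.leNat (cA y) (cA x))) (List.finRange n)
  let outputs ← sortList (fun x y => exec (.leNat (cB x) (cB y))) (List.finRange n)
  pairUp inputs outputs

end Programs

/-! ### The parameters of the complexity bounds -/

/-- `max_i d i`. -/
def maxDim {n : ℕ} (d : Fin n → ℕ) : ℕ := Finset.univ.sup d

/-- The least eigenvalue of all the frame operators of the input and of the output POVMs. -/
def lambdaMin {n : ℕ} {dA dB : Fin n → ℕ} (P : ∀ i, ICPOVM (dA i)) (Q : ∀ j, ICPOVM (dB j)) : ℝ :=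
  min (⨅ i, frameLambdaMin (P i).toPOVM) (⨅ j, frameLambdaMin (Q j).toPOVM)

/-- `d_A⁴ d_B⁴ λ_min⁻² χ_min⁻² log (n d_A d_B κ⁻¹)`. -/
def queryBound {n : ℕ} {dA dB : Fin n → ℕ} (P : ∀ i, ICPOVM (dA i)) (Q : ∀ j, ICPOVM (dB j))
    (χmin κ : ℝ) : ℝ :=
  (maxDim dA : ℝ) ^ 4 * (maxDim dB : ℝ) ^ 4 * (lambdaMin P Q ^ 2)⁻¹ * (χmin ^ 2)⁻¹ *
    Real.log (n * maxDim dA * maxDim dB / κ)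

end CausalOrder

end

open CausalOrder

namespace CausalOrder

/-! ### Laws and costs of programs -/

section Semantics

variable {n : ℕ} {dA dB : Fin n → ℕ} (C : Channel (Joint dA) (Joint dB))

/-! The randomised preparation simulates a measurement on the Choi state. Choosing `α` with
probability `Tr P_α / d` and preparing `P_αᵀ / Tr P_α` contributes `P_αᵀ / d`, since the traces
cancel, and feeding `P_αᵀ / d` into the channel is the same as contracting the input half of the
Choi state with `P_α`. Summing over the inputs and outcomes of all other wires replaces their POVM
elements by the identity and so traces those wires out. Hence one use of the channel gives, for
every pair `(i, j)` at once, a sample of the POVM `{P_α ⊗ Q_β}` on the marginal of `A_i` and `B_j`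
(`sum_sampleWeight_eq_pairProb`), and different uses are independent (`samples_apply`).

Write `D = d_A d_B`. Linear inversion is exact on exact probabilities and amplifies Frobenius errors
by at most `1 / λ_min` (`norm_reconstructed_sub_le`). Near a state, `χ₁` is Lipschitz in Frobenius
norm with constant `4 D` (`abs_chiOne_sub_le`, which rests on the triangle inequality
`traceNorm_add_le`). So if every frequency is accurate to `t = λ_min χ_min / (16 D²)`, every `χ₁` is
off by at most `χ_min / 4`, and the threshold `χ_min / 2` separates the value 0 from the values at
least `χ_min`. An exponential tail bound (`sum_prod_deviation_le`) and a union bound over at most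
`n² D²` frequencies give the number of samples.

If all decisions are correct, then, counting teeth from 0, the input of tooth `i` has `n - i`
correlations and the output of tooth `j` has `j + 1`. Inputs have pairwise different counts, and so
do outputs, so sorting recovers the order (`causalOrderOf_eq`).

For the running time, the tomography of a pair costs `O(D⁴)` besides reading the data. This is
absorbed into `N`, because `λ_min² D ≤ 1` and `χ_min ≤ 2 √D` force `X ≥ D⁴ / 8`
(`TotallyCorrelated.le_queryBound`). -/

theorem Prog.bind_def {α β : Type} (p : Prog dA dB α) (f : α → Prog dA dB β) :
    p >>= f = p.bind f := rfl

theorem Prog.pure_def {α : Type} (x : α) : (pure x : Prog dA dB α) = .ret x := rfl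

/-- The distribution of the value returned by a program. -/
noncomputable def Prog.law {α : Type} (p : Prog dA dB α) : PMF α := (p.run C).map Outcome.value

/-- Costs are additive, so a charge made before a bind can be moved past it; this is `key`, and with
it each constructor reduces to the induction hypothesis. -/
theorem Prog.run_bind {α β : Type} (p : Prog dA dB α) (f : α → Prog dA dB β) :
    (p.bind f).run C =
      (p.run C).bind fun r => ((f r.value).run C).map (Outcome.charge r.time r.queries) := by
  have key : ∀ (t q : ℕ) (μ : PMF (Outcome α)),
      (μ.bind fun r => ((f r.value).run C).map (Outcome.charge r.time r.queries)).map
          (Outcome.charge t q) =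
        (μ.map (Outcome.charge t q)).bind fun r =>
          ((f r.value).run C).map (Outcome.charge r.time r.queries) := by
    intro t q μ
    rw [PMF.map_bind, PMF.bind_map]
    congr 1
    funext r
    rw [PMF.map_comp]
    simp only [Function.comp, Outcome.charge]
    congr 1
    funext s
    simp [Outcome.charge, add_assoc]
  induction p with
  | ret x =>
    simp only [Prog.bind, Prog.run, PMF.pure_bind]
    rw [show Outcome.charge 0 0 = (id : Outcome β → Outcome β) by
      funext r; simp [Outcome.charge], PMF.map_id]
  | instr i k ih =>
    simp only [Prog.bind, Prog.run]
    rw [← key, ih]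
  | draw p k ih =>
    simp only [Prog.bind, Prog.run]
    rw [← key, PMF.bind_bind]
    simp only [ih]
  | query ρ M k ih =>
    simp only [Prog.bind, Prog.run]
    rw [← key, PMF.bind_bind]
    simp only [ih]

@[simp] theorem Prog.law_bind {α β : Type} (p : Prog dA dB α) (f : α → Prog dA dB β) :
    (p >>= f).law C = (p.law C).bind fun x => (f x).law C := by
  rw [Prog.bind_def, Prog.law, Prog.run_bind, PMF.map_bind, Prog.law, PMF.bind_map]
  simp only [PMF.map_comp]
  rfl

@[simp] theorem Prog.law_pure {α : Type} (x : α) :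
    (pure x : Prog dA dB α).law C = PMF.pure x := by
  rw [Prog.pure_def, Prog.law, Prog.run, PMF.pure_map]

@[simp] theorem Prog.law_exec {β : Type} (i : Instr β) :
    (exec i : Prog dA dB β).law C = PMF.pure i.eval := by
  simp [exec, Prog.law, Prog.run, PMF.pure_map, Outcome.charge]

@[simp] theorem Prog.law_drawFrom {m : ℕ} (p : PMF (Fin m)) :
    (drawFrom p : Prog dA dB (Fin m)).law C = p := by
  simp [drawFrom, Prog.law, Prog.run, PMF.map_bind, PMF.pure_map, Outcome.charge]

@[simp] theorem Prog.law_useChannel {m : Fin n → ℕ} (ρ : ∀ i, DensityOp (dA i))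
    (M : ∀ j, POVM (dB j) (m j)) :
    (useChannel ρ M : Prog dA dB (Joint m)).law C = born C ρ M := by
  simp [useChannel, Prog.law, Prog.run, PMF.map_bind, PMF.pure_map, Outcome.charge]

/-- The law of a loop all of whose steps are deterministic. -/
theorem law_loop {ι β : Type} (l : List ι) (init : β) {body : β → ι → Prog dA dB β}
    {g : β → ι → β} (h : ∀ s x, (body s x).law C = PMF.pure (g s x)) :
    (loop l init body).law C = PMF.pure (l.foldl g init) := by
  induction l generalizing init with
  | nil => simp [loop]
  | cons x l ih => simp [loop, h, ih]

/-- The results of the iterations of `forEach` are independent. -/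
theorem law_forEach_apply {m : ℕ} {β : Fin m → Type} (body : (i : Fin m) → Prog dA dB (β i))
    (x : (i : Fin m) → β i) :
    (forEach body).law C x = ∏ i, (body i).law C (x i) := by
  classical
  induction m with
  | zero =>
    simp only [forEach, Prog.law_pure, Finset.univ_eq_empty, Finset.prod_empty, PMF.pure_apply]
    rw [if_pos (Subsingleton.elim _ _)]
  | succ m ih =>
    simp only [forEach, Prog.law_bind, Prog.law_exec, PMF.pure_bind, Prog.law_pure]
    -- `Fin.cons` determines its head and its tail, so only one term survives in each of the two
    -- nested sums.
    rw [PMF.bind_apply, Fin.prod_univ_succ, tsum_eq_single (x 0)]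
    · rw [PMF.bind_apply, tsum_eq_single (fun i => x i.succ : (i : Fin m) → β i.succ)]
      · rw [ih]
        simp only [PMF.pure_apply]
        rw [if_pos, mul_one]
        exact (Fin.cons_self_tail x).symm
      · intro y hy
        rw [PMF.pure_apply, if_neg, mul_zero]
        intro h
        apply hy
        funext i
        rw [h, Fin.cons_succ]
    · intro y hy
      rw [PMF.bind_apply]
      simp only [PMF.pure_apply]
      rw [ENNReal.tsum_eq_zero.mpr, mul_zero]
      intro z
      rw [if_neg, mul_zero]
      intro h
      apply hy
      rw [h, Fin.cons_zero]

theorem law_forEach {m : ℕ} {β : Fin m → Type} {body : (i : Fin m) → Prog dA dB (β i)}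
    {v : (i : Fin m) → β i} (h : ∀ i, (body i).law C = PMF.pure (v i)) :
    (forEach body).law C = PMF.pure v := by
  classical
  ext x
  rw [law_forEach_apply]
  simp only [h, PMF.pure_apply]
  by_cases hx : x = v
  · simp [hx]
  · obtain ⟨i, hi⟩ := Function.ne_iff.mp hx
    rw [if_neg hx]
    exact Finset.prod_eq_zero (Finset.mem_univ i) (if_neg hi)

theorem law_sumOver {m : ℕ} {term : Fin m → Prog dA dB ℂ} {v : Fin m → ℂ}
    (h : ∀ i, (term i).law C = PMF.pure (v i)) :
    (sumOver term).law C = PMF.pure (∑ i, v i) := by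
  rw [sumOver, law_loop C (g := fun s i => s + v i)]
  · congr 1
    rw [← List.sum_ofFn, List.ofFn_eq_map, List.sum_eq_foldl, List.foldl_map]
  · intro s i
    simp [h, Instr.eval]

/-- Every run of the program takes time at most `T` and uses the channel `q` times. -/
def Prog.Bounded {α : Type} (p : Prog dA dB α) (T q : ℕ) : Prop :=
  ∀ r ∈ (p.run C).support, r.time ≤ T ∧ r.queries = q

variable {C}

theorem Prog.Bounded.mono {α : Type} {p : Prog dA dB α} {T T' q : ℕ} (h : p.Bounded C T q)
    (hT : T ≤ T') : p.Bounded C T' q :=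
  fun r hr => ⟨(h r hr).1.trans hT, (h r hr).2⟩

theorem Prog.Bounded.bind {α β : Type} {p : Prog dA dB α} {f : α → Prog dA dB β}
    {T T' q q' : ℕ} (hp : p.Bounded C T q) (hf : ∀ x, (f x).Bounded C T' q') :
    (p >>= f).Bounded C (T + T') (q + q') := by
  intro r hr
  rw [Prog.bind_def, Prog.run_bind, PMF.mem_support_bind_iff] at hr
  obtain ⟨s, hs, hr⟩ := hr
  rw [PMF.mem_support_map_iff] at hr
  obtain ⟨r', hr', rfl⟩ := hr
  have h1 := hp s hs
  have h2 := hf _ r' hr'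
  simp only [Outcome.charge]
  omega

/-- Composition with a program that does not use the channel, on the left. -/
theorem Prog.Bounded.bind_zero {α β : Type} {p : Prog dA dB α} {f : α → Prog dA dB β}
    {T T' q : ℕ} (hp : p.Bounded C T 0) (hf : ∀ x, (f x).Bounded C T' q) :
    (p >>= f).Bounded C (T + T') q := by
  simpa using hp.bind hf

theorem Prog.bounded_pure {α : Type} (x : α) : (pure x : Prog dA dB α).Bounded C 0 0 := by
  intro r hr
  rw [Prog.pure_def, Prog.run, PMF.mem_support_pure_iff] at hr
  subst hr
  simp

theorem Prog.bounded_exec {β : Type} (i : Instr β) :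
    (exec i : Prog dA dB β).Bounded C i.cost 0 := by
  intro r hr
  simp only [exec, Prog.run, PMF.pure_map, PMF.mem_support_pure_iff] at hr
  subst hr
  simp [Outcome.charge]

theorem Prog.bounded_drawFrom {m : ℕ} (p : PMF (Fin m)) :
    (drawFrom p : Prog dA dB (Fin m)).Bounded C (Nat.log 2 m + 1) 0 := by
  intro r hr
  simp only [drawFrom, Prog.run, PMF.mem_support_map_iff, PMF.mem_support_bind_iff,
    PMF.mem_support_pure_iff] at hr
  obtain ⟨s, ⟨x, -, rfl⟩, rfl⟩ := hr
  simp [Outcome.charge]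

theorem Prog.bounded_useChannel {m : Fin n → ℕ} (ρ : ∀ i, DensityOp (dA i))
    (M : ∀ j, POVM (dB j) (m j)) :
    (useChannel ρ M : Prog dA dB (Joint m)).Bounded C
      ((∑ i, dA i) + 1 + ∑ j, m j ^ 2) 1 := by
  intro r hr
  simp only [useChannel, Prog.run, PMF.mem_support_map_iff, PMF.mem_support_bind_iff,
    PMF.mem_support_pure_iff] at hr
  obtain ⟨s, ⟨x, -, rfl⟩, rfl⟩ := hr
  simp [Outcome.charge]

theorem bounded_loop {ι β : Type} (l : List ι) (init : β) {body : β → ι → Prog dA dB β} {T : ℕ}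
    (h : ∀ s x, (body s x).Bounded C T 0) :
    (loop l init body).Bounded C (l.length * (1 + T)) 0 := by
  induction l generalizing init with
  | nil => simpa [loop] using Prog.bounded_pure init
  | cons x l ih =>
    exact ((Prog.bounded_exec _).bind_zero fun _ => (h init x).bind_zero fun s => ih s).mono
      (by simp only [Instr.cost, List.length_cons]; lia)

theorem bounded_forEach {m : ℕ} {β : Fin m → Type} {body : (i : Fin m) → Prog dA dB (β i)}
    {T q : ℕ} (h : ∀ i, (body i).Bounded C T q) :
    (forEach body).Bounded C (m * (1 + T)) (m * q) := by
  induction m with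
  | zero => simpa [forEach] using Prog.bounded_pure _
  | succ m ih =>
    have := (Prog.bounded_exec .tick).bind_zero fun _ => (h 0).bind fun x =>
      (ih fun i => h i.succ).bind fun xs =>
        Prog.bounded_pure (Fin.cons x xs : (i : Fin (m + 1)) → β i)
    have e : q + (m * q + 0) = (m + 1) * q := by ring
    rw [e] at this
    exact this.mono (by simp only [Instr.cost]; lia)

theorem bounded_forEach_zero {m : ℕ} {β : Fin m → Type} {body : (i : Fin m) → Prog dA dB (β i)}
    {T : ℕ} (h : ∀ i, (body i).Bounded C T 0) :
    (forEach body).Bounded C (m * (1 + T)) 0 := by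
  simpa using bounded_forEach h

theorem bounded_sumOver {m : ℕ} {term : Fin m → Prog dA dB ℂ} {T : ℕ}
    (h : ∀ i, (term i).Bounded C T 0) : (sumOver term).Bounded C (m * (2 + T)) 0 := by
  have := bounded_loop (C := C) (List.finRange m) (0 : ℂ)
    (body := fun s i => term i >>= fun t => exec (.add s t)) (T := T + 1)
    fun s i => (h i).bind_zero fun t => Prog.bounded_exec _
  exact this.mono (by rw [List.length_finRange]; lia)

end Semantics

/-! ### The values computed by the algorithm -/

section Values

variable {n : ℕ} {dA dB : Fin n → ℕ} (C : Channel (Joint dA) (Joint dB))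

theorem Prog.law_bind_of_pure {α β : Type} {p : Prog dA dB α} {x : α} (h : p.law C = PMF.pure x)
    (f : α → Prog dA dB β) : (p >>= f).law C = (f x).law C := by
  rw [Prog.law_bind, h, PMF.pure_bind]

/-- The empirical frequencies of a sequence of pairs. -/
noncomputable def empirical {N m m' : ℕ} (data : Fin N → Fin m × Fin m') :
    Fin m → Fin m' → ℂ :=
  fun α β => ∑ k, if data k = (α, β) then 1 / (N : ℂ) else 0

/-- Each step of the fold raises exactly one entry of the table by `w`, so an entry gains `w` once
for every occurrence of its index in the data. -/
theorem foldl_update_apply {N m m' : ℕ} (data : Fin N → Fin m × Fin m') (w : ℂ)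
    (l : List (Fin N)) (p : Fin m → Fin m' → ℂ) (α : Fin m) (β : Fin m') :
    l.foldl (fun (p : Fin m → Fin m' → ℂ) k => Function.update p (data k).1
      (Function.update (p (data k).1) (data k).2 (p (data k).1 (data k).2 + w))) p α β =
      p α β + (l.map fun k => if data k = (α, β) then w else 0).sum := by
  induction l generalizing p with
  | nil => simp
  | cons k l ih =>
    rw [List.foldl_cons, ih, List.map_cons, List.sum_cons, ← add_assoc]
    congr 1
    by_cases h1 : α = (data k).1
    · subst h1
      by_cases h2 : β = (data k).2
      · subst h2
        simp
      · have : data k ≠ ((data k).1, β) := fun h => h2 (congrArg Prod.snd h).symm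
        simp [h2, this]
    · have : data k ≠ (α, β) := fun h => h1 (congrArg Prod.fst h).symm
      simp [h1, this]

theorem law_frequencies {N m m' : ℕ} (data : Fin N → Fin m × Fin m') :
    (frequencies data).law C = PMF.pure (empirical data) := by
  unfold frequencies
  rw [Prog.law_bind_of_pure C (law_forEach C fun _ => law_forEach C fun _ => Prog.law_pure C _),
    Prog.law_bind_of_pure C (Prog.law_exec C _),
    law_loop C (g := fun (p : Fin m → Fin m' → ℂ) k => Function.update p (data k).1
      (Function.update (p (data k).1) (data k).2
        (p (data k).1 (data k).2 + (Instr.div 1 (N : ℂ)).eval)))]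
  · congr 1
    funext α β
    rw [foldl_update_apply, zero_add, empirical, ← List.sum_ofFn, List.ofFn_eq_map]
    rfl
  · intro s x
    simp [Instr.eval]

/-- The operator `ρ̂` with `|ρ̂⟫ = (F⁻¹ S† ⊗ G⁻¹ R†) |p⟫`. -/
noncomputable def reconstructed {a b : ℕ} (P : ICPOVM a) (Q : ICPOVM b)
    (p : Fin (a ^ 2) → Fin (b ^ 2) → ℂ) : Matrix (Fin a × Fin b) (Fin a × Fin b) ℂ :=
  Matrix.of fun s t => ∑ u, ∑ u', ∑ v, ∑ v',
    (frameOp P.toPOVM)⁻¹ (s.1, t.1) (u, u') * (frameOp Q.toPOVM)⁻¹ (s.2, t.2) (v, v') *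
      ∑ α, ∑ β, vectorize (P.elem α) (u, u') * vectorize (Q.elem β) (v, v') * p α β

theorem law_reconstruct {a b : ℕ} (P : ICPOVM a) (Q : ICPOVM b)
    (p : Fin (a ^ 2) → Fin (b ^ 2) → ℂ) :
    (reconstruct P Q p).law C = PMF.pure (reconstructed P Q p) := by
  unfold reconstruct
  rw [Prog.law_bind_of_pure C (law_forEach C fun u => law_forEach C fun u' =>
    law_forEach C fun v => law_forEach C fun v' => law_sumOver C
      (v := fun α => ∑ β, vectorize (P.elem α) (u, u') * vectorize (Q.elem β) (v, v') * p α β)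
      fun α => law_sumOver C fun β => by simp [Instr.eval]),
    Prog.law_bind_of_pure C (law_forEach C fun x => law_forEach C fun x' =>
    law_forEach C fun y => law_forEach C fun y' => law_sumOver C
      (v := fun u => ∑ u', ∑ v, ∑ v',
        (frameOp P.toPOVM)⁻¹ (x, x') (u, u') * (frameOp Q.toPOVM)⁻¹ (y, y') (v, v') *
        ∑ α, ∑ β, vectorize (P.elem α) (u, u') * vectorize (Q.elem β) (v, v') * p α β)
      fun u => law_sumOver C fun u' => law_sumOver C fun v => law_sumOver C fun v' => by
        simp [Instr.eval])]
  rw [Prog.law_pure]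
  rfl

theorem law_computeChiOne {a b : ℕ} (ρ : Matrix (Fin a × Fin b) (Fin a × Fin b) ℂ) :
    (computeChiOne ρ : Prog dA dB ℝ).law C = PMF.pure (chiOne ρ) := by
  unfold computeChiOne
  rw [Prog.law_bind_of_pure C (law_forEach C (v := traceRight ρ) fun x => law_forEach C fun x' =>
      law_sumOver C fun y => Prog.law_pure C _),
    Prog.law_bind_of_pure C (law_forEach C (v := traceLeft ρ) fun y => law_forEach C fun y' =>
      law_sumOver C fun x => Prog.law_pure C _),
    Prog.law_bind_of_pure C (law_forEach C fun x => law_forEach C fun y =>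
      law_forEach C fun x' => law_forEach C
        (v := fun y' => ρ (x, y) (x', y') - traceRight ρ x x' * traceLeft ρ y y')
        fun y' => by simp [Instr.eval]), Prog.law_exec]
  rfl

theorem law_estimateChiOne {N a b : ℕ} (P : ICPOVM a) (Q : ICPOVM b)
    (data : Fin N → Fin (a ^ 2) × Fin (b ^ 2)) :
    (estimateChiOne P Q data).law C =
      PMF.pure (chiOne (reconstructed P Q (empirical data))) := by
  unfold estimateChiOne
  rw [Prog.law_bind_of_pure C (law_frequencies C _),
    Prog.law_bind_of_pure C (law_reconstruct C _ _ _),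
    law_computeChiOne]

/-- The instruction decides the comparison classically, while sorting uses the instance on `ℕ`; as
Booleans the two agree. -/
theorem law_leNat (x y : ℕ) :
    (exec (.leNat x y) : Prog dA dB Bool).law C = PMF.pure (decide (x ≤ y)) :=
  (Prog.law_exec C _).trans (congrArg PMF.pure (decide_eq_decide.mpr Iff.rfl))

theorem law_countFalse {m : ℕ} (v : Fin m → Bool) :
    (countFalse v : Prog dA dB ℕ).law C =
      PMF.pure (Finset.univ.filter fun i => v i = false).card := by
  unfold countFalse
  rw [law_loop C (g := fun c i => if v i then c else c + 1)]
  · congr 1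
    have : ∀ (l : List (Fin m)) (c : ℕ), l.foldl (fun c i => if v i then c else c + 1) c =
        c + (l.map fun i => if v i = false then 1 else 0).sum := by
      intro l
      induction l with
      | nil => simp
      | cons i l ih =>
        intro c
        rw [List.foldl_cons, ih]
        cases h : v i <;> simp [h, add_assoc]
    rw [this, zero_add, Finset.card_filter, ← List.sum_ofFn, List.ofFn_eq_map]
  · intro s x
    cases h : v x <;> simp [Instr.eval]

/-! ### Sorting, pairing, and the law of the whole algorithm -/

variable {ι : Type} {before : ι → ι → Prog dA dB Bool} {r : ι → ι → Prop} [DecidableRel r]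

theorem law_insertSorted (h : ∀ x y, (before x y).law C = PMF.pure (decide (r x y)))
    (x : ι) (l : List ι) :
    (insertSorted before x l).law C = PMF.pure (l.orderedInsert r x) := by
  induction l with
  | nil => simp [insertSorted]
  | cons y l ih =>
    simp only [insertSorted, Prog.law_bind, Prog.law_exec, PMF.pure_bind, h]
    by_cases hr : r x y
    · simp [hr]
    · simp [hr, ih]

theorem law_sortList (h : ∀ x y, (before x y).law C = PMF.pure (decide (r x y)))
    (l : List ι) : (sortList before l).law C = PMF.pure (l.insertionSort r) := by
  induction l with
  | nil => simp [sortList]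
  | cons x l ih =>
    simp [sortList, ih, law_insertSorted C h]

theorem law_pairUp (l l' : List ι) :
    (pairUp l l' : Prog dA dB _).law C = PMF.pure (l.zip l') := by
  induction l generalizing l' with
  | nil => simp [pairUp]
  | cons x l ih =>
    cases l' with
    | nil => simp [pairUp]
    | cons y l' => simp [pairUp, ih]

/-- The decisions of the independence tests, from the outcomes of the `N` uses of the channel. -/
noncomputable def decisions (P : ∀ i, ICPOVM (dA i)) (Q : ∀ j, ICPOVM (dB j)) (threshold : ℝ)
    {N : ℕ} (a : Fin N → Joint fun i => dA i ^ 2) (b : Fin N → Joint fun j => dB j ^ 2) :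
    Fin n → Fin n → Bool :=
  fun i j => (Instr.leReal
    (chiOne (reconstructed (P i) (Q j) (empirical fun k => (a k i, b k j)))) threshold).eval

/-- The distribution of the inputs and the outcomes of `N` uses of the channel. -/
noncomputable def samples [∀ i, NeZero (dA i)] (P : ∀ i, ICPOVM (dA i)) (Q : ∀ j, ICPOVM (dB j))
    (N : ℕ) : PMF ((Fin N → Joint fun i => dA i ^ 2) × (Fin N → Joint fun j => dB j ^ 2)) :=
  ((forEach fun _ : Fin N => forEach fun i : Fin n => drawFrom (P i).inputDist :
      Prog dA dB _).law C).bind fun a =>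
    ((forEach fun k : Fin N =>
      useChannel (fun i => (P i).state (a k i)) fun j => (Q j).toPOVM :
      Prog dA dB _).law C).map fun b => (a, b)

/-- All inputs are drawn before the first use of the channel, but use `k` depends only on the inputs
of round `k`. The joint law therefore factorises over the rounds: the data are `N` independent
samples of one distribution. -/
theorem samples_apply [∀ i, NeZero (dA i)] (P : ∀ i, ICPOVM (dA i)) (Q : ∀ j, ICPOVM (dB j))
    (N : ℕ) (a : Fin N → Joint fun i => dA i ^ 2) (b : Fin N → Joint fun j => dB j ^ 2) :
    samples C P Q N (a, b) = ∏ k, ((∏ i, (P i).inputDist (a k i)) *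
      born C (fun i => (P i).state (a k i)) (fun j => (Q j).toPOVM) (b k)) := by
  classical
  rw [samples, PMF.bind_apply, tsum_eq_single a, PMF.map_apply, tsum_eq_single b]
  · rw [if_pos rfl, law_forEach_apply, law_forEach_apply, ← Finset.prod_mul_distrib]
    refine Finset.prod_congr rfl fun k _ => ?_
    rw [law_forEach_apply]
    simp
  · intro b' hb
    rw [if_neg]
    intro h
    exact hb (congrArg Prod.snd h).symm
  · intro a' ha
    rw [PMF.map_apply, ENNReal.tsum_eq_zero.mpr, mul_zero]
    intro b'
    rw [if_neg]
    intro h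
    exact ha (congrArg Prod.fst h).symm

theorem law_independence [∀ i, NeZero (dA i)] (P : ∀ i, ICPOVM (dA i)) (Q : ∀ j, ICPOVM (dB j))
    (N : ℕ) (threshold : ℝ) :
    (independence P Q N threshold).law C =
      (samples C P Q N).map fun s => decisions P Q threshold s.1 s.2 := by
  unfold independence samples
  rw [Prog.law_bind, PMF.map_bind]
  congr 1
  funext a
  rw [Prog.law_bind, PMF.map_comp, PMF.map]
  congr 1
  funext b
  refine law_forEach C fun i => law_forEach C fun j => ?_
  rw [Prog.law_bind_of_pure C (law_estimateChiOne C _ _ _), Prog.law_exec]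
  rfl

/-- The order that the algorithm derives from the decisions of the independence tests. -/
def causalOrderOf (ind : Fin n → Fin n → Bool) : List (Fin n × Fin n) :=
  ((List.finRange n).insertionSort fun x y =>
      (Finset.univ.filter fun j => ind y j = false).card ≤
        (Finset.univ.filter fun j => ind x j = false).card).zip
    ((List.finRange n).insertionSort fun x y =>
      (Finset.univ.filter fun i => ind i x = false).card ≤
        (Finset.univ.filter fun i => ind i y = false).card)

theorem law_discoverOrder [∀ i, NeZero (dA i)] (P : ∀ i, ICPOVM (dA i)) (Q : ∀ j, ICPOVM (dB j))
    (N : ℕ) (χmin : ℝ) :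
    (discoverOrder P Q N χmin).law C =
      (samples C P Q N).map fun s => causalOrderOf (decisions P Q (χmin / 2) s.1 s.2) := by
  unfold discoverOrder
  rw [Prog.law_bind, law_independence, PMF.bind_map, PMF.map]
  congr 1
  funext s
  simp only [Function.comp]
  generalize decisions P Q (χmin / 2) s.1 s.2 = ind
  rw [Prog.law_bind_of_pure C (law_forEach C fun i => law_countFalse C _),
    Prog.law_bind_of_pure C (law_forEach C fun j => law_countFalse C _),
    Prog.law_bind_of_pure C (law_sortList C (r := fun x y =>
      (Finset.univ.filter fun j => ind y j = false).card ≤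
        (Finset.univ.filter fun j => ind x j = false).card) (fun x y => law_leNat C _ _) _),
    Prog.law_bind_of_pure C (law_sortList C (r := fun x y =>
      (Finset.univ.filter fun i => ind i x = false).card ≤
        (Finset.univ.filter fun i => ind i y = false).card) (fun x y => law_leNat C _ _) _),
    law_pairUp]
  rfl

end Values

/-! ### Correct decisions give the correct order -/

/-- The hypothesis makes `r` the linear order of `Fin n` transported by `τ`. A linear order has only
one sorted arrangement of a given list, and `List.ofFn τ` is one. -/
theorem insertionSort_finRange {n : ℕ} (r : Fin n → Fin n → Prop) [DecidableRel r]
    (τ : Equiv.Perm (Fin n)) (h : ∀ i j, r (τ i) (τ j) ↔ i ≤ j) :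
    (List.finRange n).insertionSort r = List.ofFn τ := by
  have h' : ∀ x y, r x y ↔ τ.symm x ≤ τ.symm y := fun x y => by
    simpa using h (τ.symm x) (τ.symm y)
  have : Std.Total r := ⟨fun x y => by rw [h', h']; exact le_total _ _⟩
  have : IsTrans (Fin n) r := ⟨fun x y z => by rw [h', h', h']; exact le_trans⟩
  refine List.Perm.eq_of_pairwise (le := r) (fun x y _ _ hxy hyx => ?_)
    (List.pairwise_insertionSort r _) ?_ ?_
  · rw [h'] at hxy hyx
    exact τ.symm.injective (le_antisymm hxy hyx)
  · rw [List.pairwise_ofFn]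
    intro i j hij
    exact (h i j).mpr hij.le
  · refine (List.perm_insertionSort r _).trans ?_
    refine (List.perm_ext_iff_of_nodup (List.nodup_finRange n)
      (List.nodup_ofFn.mpr τ.injective)).mpr fun x => ?_
    simp only [List.mem_finRange, List.mem_ofFn, true_iff]
    exact τ.surjective x

theorem card_filter_comp_perm {n : ℕ} (v : Fin n → Bool) (τ : Equiv.Perm (Fin n)) :
    (Finset.univ.filter fun j => v j = false).card =
      (Finset.univ.filter fun j => v (τ j) = false).card := by
  rw [Finset.card_filter, Finset.card_filter]
  exact (Equiv.sum_comp τ fun j => if v j = false then 1 else 0).symm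

/-- The counts are `n - i` for the input of tooth `i` and `j + 1` for the output of tooth `j`. They
are strictly monotone in the position of the tooth, so there are no ties and the sorts are forced.
-/
theorem causalOrderOf_eq {n : ℕ} (ind : Fin n → Fin n → Bool) (σ π : Equiv.Perm (Fin n))
    (h : ∀ i j, ind (σ i) (π j) = decide (j < i)) :
    causalOrderOf ind = List.ofFn fun k => (σ k, π k) := by
  have hA : ∀ i, (Finset.univ.filter fun j => ind (σ i) j = false).card = n - i := by
    intro i
    rw [card_filter_comp_perm _ π]
    simp only [h, decide_eq_false_iff_not, not_lt]
    rw [show (Finset.univ.filter fun j => i ≤ j) = Finset.Ici i by ext; simp, Fin.card_Ici]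
  have hB : ∀ j, (Finset.univ.filter fun i => ind i (π j) = false).card = j + 1 := by
    intro j
    rw [card_filter_comp_perm (fun i => ind i (π j)) σ]
    simp only [h, decide_eq_false_iff_not, not_lt]
    rw [show (Finset.univ.filter fun i => i ≤ j) = Finset.Iic j by ext; simp, Fin.card_Iic]
  rw [causalOrderOf, insertionSort_finRange _ σ, insertionSort_finRange _ π]
  · refine List.ext_getElem (by simp) fun k h1 h2 => ?_
    simp
  · intro i j
    rw [hB, hB, Fin.le_iff_val_le_val]
    omega
  · intro i j
    rw [hA, hA, Fin.le_iff_val_le_val]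
    omega

/-! ### The running time -/

section Cost

variable {n : ℕ} {dA dB : Fin n → ℕ} {C : Channel (Joint dA) (Joint dB)}

/-- `Prog.Bounded.bind` needs one bound for all conceivable intermediate values. When the cost of
the continuation depends on the length of an intermediate list there is no such bound, but a
deterministic law leaves a single value to consider. -/
theorem Prog.Bounded.bind_of_law {α β : Type} {p : Prog dA dB α} {f : α → Prog dA dB β}
    {T T' q : ℕ} {x : α} (hp : p.Bounded C T 0) (hx : p.law C = PMF.pure x)
    (hf : (f x).Bounded C T' q) : (p >>= f).Bounded C (T + T') q := by
  intro r hr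
  rw [Prog.bind_def, Prog.run_bind, PMF.mem_support_bind_iff] at hr
  obtain ⟨s, hs, hr⟩ := hr
  rw [PMF.mem_support_map_iff] at hr
  obtain ⟨r', hr', rfl⟩ := hr
  have hv : s.value = x := by
    have : s.value ∈ (p.law C).support :=
      (PMF.mem_support_map_iff _ _ _).mpr ⟨s, hs, rfl⟩
    rwa [hx, PMF.mem_support_pure_iff] at this
  rw [hv] at hr'
  have h1 := hp s hs
  have h2 := hf r' hr'
  simp only [Outcome.charge]
  omega

/-- The overhead of the loop is traded for a factor 2, so that bounds for nested loops are monomials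
that multiply. The price is `1 ≤ T` at every level, which is why the dimensions must be positive
below. -/
theorem bounded_forEach_le {m : ℕ} {β : Fin m → Type} {body : (i : Fin m) → Prog dA dB (β i)}
    {T : ℕ} (hT : 1 ≤ T) (h : ∀ i, (body i).Bounded C T 0) :
    (forEach body).Bounded C (2 * m * T) 0 :=
  (bounded_forEach_zero h).mono (by nlinarith)

theorem bounded_sumOver_le {m : ℕ} {term : Fin m → Prog dA dB ℂ} {T : ℕ} (hT : 1 ≤ T)
    (h : ∀ i, (term i).Bounded C T 0) : (sumOver term).Bounded C (3 * m * T) 0 :=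
  (bounded_sumOver h).mono (by nlinarith)

theorem bounded_frequencies {N m m' : ℕ} (data : Fin N → Fin m × Fin m') :
    (frequencies data : Prog dA dB _).Bounded C (m * (1 + m') + (1 + N * 2)) 0 := by
  unfold frequencies
  refine ((bounded_forEach_zero fun _ => (bounded_forEach_zero fun _ =>
    Prog.bounded_pure _).mono (T' := m') (by lia))).bind_zero fun zero =>
      (Prog.bounded_exec _).bind_zero fun w => ?_
  have := bounded_loop (C := C) (List.finRange N) zero (T := 1)
    (body := fun p k => exec (.add (p (data k).1 (data k).2) w) >>= fun x =>
      pure (Function.update p (data k).1 (Function.update (p (data k).1) (data k).2 x)))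
    fun s x => (Prog.bounded_exec _).bind_zero fun _ => Prog.bounded_pure _
  rwa [List.length_finRange] at this

theorem bounded_mul_mul (x y z : ℂ) :
    ((exec (.mul x y) : Prog dA dB ℂ) >>= fun t => exec (.mul t z)).Bounded C 2 0 :=
  (Prog.bounded_exec _).bind_zero fun _ => Prog.bounded_exec _

theorem bounded_mul_sub (x y z : ℂ) :
    ((exec (.mul x y) : Prog dA dB ℂ) >>= fun t => exec (.sub z t)).Bounded C 2 0 :=
  (Prog.bounded_exec _).bind_zero fun _ => Prog.bounded_exec _

/-- The two stages cost `2⁴ · 3² · 2 = 288` and `2⁴ · 3⁴ · 2 = 2592` times `a⁴ b⁴`: factors 2 for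
the entry loops, 3 for the sums, and 2 for the two products in the body. Applying `S† ⊗ R†` and the
inverse frame operators one after the other keeps the exponents at 4. -/
theorem bounded_reconstruct {a b : ℕ} (ha : 1 ≤ a) (hb : 1 ≤ b) (P : ICPOVM a) (Q : ICPOVM b)
    (p : Fin (a ^ 2) → Fin (b ^ 2) → ℂ) :
    (reconstruct P Q p : Prog dA dB _).Bounded C (2880 * (a ^ 4 * b ^ 4)) 0 := by
  unfold reconstruct
  have h1 := (bounded_forEach_le (C := C) (m := a) ?_ fun u =>
    bounded_forEach_le (m := a) ?_ fun u' =>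
    bounded_forEach_le (m := b) ?_ fun v => bounded_forEach_le (m := b) ?_ fun v' =>
      bounded_sumOver_le (m := a ^ 2) ?_ fun α =>
      bounded_sumOver_le (m := b ^ 2) (by norm_num) fun β =>
        bounded_mul_mul (vectorize (P.elem α) (u, u')) (vectorize (Q.elem β) (v, v')) (p α β))
  · have h2 := fun w : Fin a → Fin a → Fin b → Fin b → ℂ =>
      (bounded_forEach_le (C := C) (m := a) ?_ fun x => bounded_forEach_le (m := a) ?_ fun x' =>
      bounded_forEach_le (m := b) ?_ fun y => bounded_forEach_le (m := b) ?_ fun y' =>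
      bounded_sumOver_le (m := a) ?_ fun u => bounded_sumOver_le (m := a) ?_ fun u' =>
      bounded_sumOver_le (m := b) ?_ fun v => bounded_sumOver_le (m := b) (by norm_num) fun v' =>
        bounded_mul_mul ((frameOp P.toPOVM)⁻¹ (x, x') (u, u'))
            ((frameOp Q.toPOVM)⁻¹ (y, y') (v, v')) (w u u' v v'))
    · exact (h1.bind_zero fun w => (h2 w).bind_zero fun r => Prog.bounded_pure _).mono
        (le_of_eq (by ring))
    all_goals exact Nat.one_le_iff_ne_zero.mpr (by positivity)
  all_goals exact Nat.one_le_iff_ne_zero.mpr (by positivity)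

/-- The terms `12 a² b`, `12 a b²`, `32 a² b²` and `a³ b³` are each raised to `a⁴ b⁴`, and `12 + 12
+ 32 + 1 = 57`. -/
theorem bounded_computeChiOne {a b : ℕ} (ha : 1 ≤ a) (hb : 1 ≤ b)
    (ρ : Matrix (Fin a × Fin b) (Fin a × Fin b) ℂ) :
    (computeChiOne ρ : Prog dA dB ℝ).Bounded C (57 * (a ^ 4 * b ^ 4)) 0 := by
  unfold computeChiOne
  have h1 := bounded_forEach_le (C := C) (m := a) ?_ fun x =>
    bounded_forEach_le (m := a) ?_ fun x' => bounded_sumOver_le (C := C) (m := b) le_rfl fun y =>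
      (Prog.bounded_pure (ρ (x, y) (x', y))).mono (Nat.zero_le 1)
  · have h2 := bounded_forEach_le (C := C) (m := b) ?_ fun y =>
      bounded_forEach_le (m := b) ?_ fun y' => bounded_sumOver_le (C := C) (m := a) le_rfl fun x =>
        (Prog.bounded_pure (ρ (x, y) (x, y'))).mono (Nat.zero_le 1)
    · have h3 := fun (ρA : Fin a → Fin a → ℂ) (ρB : Fin b → Fin b → ℂ) =>
        bounded_forEach_le (C := C) (m := a) ?_ fun x => bounded_forEach_le (m := b) ?_ fun y =>
        bounded_forEach_le (m := a) ?_ fun x' => bounded_forEach_le (m := b) (by norm_num) fun y' =>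
          bounded_mul_sub (ρA x x') (ρB y y') (ρ (x, y) (x', y'))
      · refine (h1.bind_zero fun ρA => h2.bind_zero fun ρB => (h3 ρA ρB).bind_zero fun τ =>
          Prog.bounded_exec (.traceNorm (Matrix.of fun s t => τ s.1 s.2 t.1 t.2))).mono ?_
        change 2 * a * (2 * a * (3 * b * 1)) + (2 * b * (2 * b * (3 * a * 1)) +
          (2 * a * (2 * b * (2 * a * (2 * b * 2))) + (a * b) ^ 3)) ≤ _
        have e : ∀ i j, i ≤ 4 → j ≤ 4 → a ^ i * b ^ j ≤ a ^ 4 * b ^ 4 := fun i j hi hj =>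
          Nat.mul_le_mul (Nat.pow_le_pow_right ha hi) (Nat.pow_le_pow_right hb hj)
        have e1 := e 2 1 (by norm_num) (by norm_num)
        have e2 := e 1 2 (by norm_num) (by norm_num)
        have e3 := e 2 2 (by norm_num) (by norm_num)
        have e4 := e 3 3 (by norm_num) (by norm_num)
        nlinarith
      all_goals exact Nat.one_le_iff_ne_zero.mpr (by positivity)
    all_goals exact Nat.one_le_iff_ne_zero.mpr (by positivity)
  all_goals exact Nat.one_le_iff_ne_zero.mpr (by positivity)

/-- The table of frequencies adds `2 N` and the terms `a²`, `a² b²` and `1`, hence `2880 + 57 + 3 =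
2940`. -/
theorem bounded_estimateChiOne {N a b : ℕ} (ha : 1 ≤ a) (hb : 1 ≤ b) (P : ICPOVM a) (Q : ICPOVM b)
    (data : Fin N → Fin (a ^ 2) × Fin (b ^ 2)) :
    (estimateChiOne P Q data : Prog dA dB ℝ).Bounded C (2 * N + 2940 * (a ^ 4 * b ^ 4)) 0 := by
  unfold estimateChiOne
  refine ((bounded_frequencies data).bind_zero fun p => (bounded_reconstruct ha hb P Q p).bind_zero
    fun ρ => bounded_computeChiOne ha hb ρ).mono ?_
  have e : ∀ i j, i ≤ 4 → j ≤ 4 → a ^ i * b ^ j ≤ a ^ 4 * b ^ 4 := fun i j hi hj =>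
    Nat.mul_le_mul (Nat.pow_le_pow_right ha hi) (Nat.pow_le_pow_right hb hj)
  have e1 := e 2 0 (by norm_num) (by norm_num)
  have e2 := e 2 2 (by norm_num) (by norm_num)
  have e3 := e 0 0 (by norm_num) (by norm_num)
  nlinarith

theorem bounded_independence [∀ i, NeZero (dA i)] [∀ j, NeZero (dB j)] (P : ∀ i, ICPOVM (dA i))
    (Q : ∀ j, ICPOVM (dB j)) (N : ℕ) (threshold : ℝ) {A B : ℕ} (hA : ∀ i, dA i ≤ A)
    (hB : ∀ j, dB j ≤ B) :
    (independence P Q N threshold).Bounded C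
      (N * (1 + n * (1 + 2 * A)) + (N * (1 + (n * A + 1 + n * B ^ 4)) +
        n * (1 + n * (1 + (2 * N + 2940 * (A ^ 4 * B ^ 4) + 1))))) N := by
  unfold independence
  refine (bounded_forEach_zero fun k => bounded_forEach_zero fun i =>
    (Prog.bounded_drawFrom (P i).inputDist).mono ?_).bind_zero fun a => ?_
  · have h1 : Nat.log 2 (dA i ^ 2) < 2 * dA i := by
      have hi := NeZero.pos (dA i)
      refine Nat.log_lt_of_lt_pow (by positivity) ?_
      rw [mul_comm, pow_mul]
      exact Nat.pow_lt_pow_left Nat.lt_two_pow_self (by norm_num)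
    have := hA i
    omega
  · have key := (bounded_forEach (C := C) fun k : Fin N =>
      (Prog.bounded_useChannel (fun i => (P i).state (a k i)) fun j => (Q j).toPOVM).mono
        (T' := n * A + 1 + n * B ^ 4) ?_).bind fun b =>
      bounded_forEach_zero fun i => bounded_forEach_zero fun j =>
        ((bounded_estimateChiOne (NeZero.pos (dA i)) (NeZero.pos (dB j)) (P i) (Q j)
          fun k => (a k i, b k j)).mono
          (T' := 2 * N + 2940 * (A ^ 4 * B ^ 4)) ?_).bind_zero fun χ =>
            Prog.bounded_exec (.leReal χ threshold)
    · simpa using key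
    · gcongr
      · exact (Finset.sum_le_card_nsmul _ _ _ fun i _ => hA i).trans (by simp)
      · refine (Finset.sum_le_card_nsmul _ _ (B ^ 4) fun j _ => ?_).trans (by simp)
        rw [← pow_mul]
        exact Nat.pow_le_pow_left (hB j) _
    · gcongr
      · exact hA _
      · exact hB _

theorem bounded_countFalse {m : ℕ} (v : Fin m → Bool) :
    (countFalse v : Prog dA dB ℕ).Bounded C (m * 2) 0 := by
  unfold countFalse
  have := bounded_loop (C := C) (List.finRange m) 0 (T := 1)
    (body := fun c i => if v i then pure c else exec (.succNat c)) fun s x => by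
      cases v x
      · exact Prog.bounded_exec _
      · exact (Prog.bounded_pure _).mono (Nat.zero_le 1)
  rwa [List.length_finRange] at this

variable {ι : Type} {before : ι → ι → Prog dA dB Bool}

theorem bounded_insertSorted (h : ∀ x y, (before x y).Bounded C 1 0) (x : ι) (l : List ι) :
    (insertSorted before x l).Bounded C (1 + l.length * 2) 0 := by
  induction l with
  | nil => exact (Prog.bounded_exec _).bind_zero fun _ => Prog.bounded_pure _
  | cons y l ih =>
    refine ((Prog.bounded_exec _).bind_zero (T' := 1 + (1 + l.length * 2)) fun _ =>
      (h x y).bind_zero fun c => ?_).mono (by simp only [Instr.cost, List.length_cons]; lia)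
    cases c
    · exact ih.bind_zero fun _ => Prog.bounded_pure _
    · exact (Prog.bounded_pure _).mono (Nat.zero_le _)

/-- The law of the comparison is needed because an insertion costs time linear in the length of the
already sorted tail, and only the law identifies that list. The induction step is `2 l² + 2 l + 2 ≤
2 (l + 1)²`. -/
theorem bounded_sortList {r : ι → ι → Prop} [DecidableRel r]
    (h : ∀ x y, (before x y).Bounded C 1 0)
    (hr : ∀ x y, (before x y).law C = PMF.pure (decide (r x y))) (l : List ι) :
    (sortList before l).Bounded C (2 * l.length ^ 2) 0 := by
  induction l with
  | nil => exact Prog.bounded_pure _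
  | cons x l ih =>
    refine ((Prog.bounded_exec _).bind_zero fun _ => ih.bind_of_law (law_sortList C hr l)
      (bounded_insertSorted h x _)).mono ?_
    simp only [Instr.cost, List.length_cons, List.length_insertionSort]
    lia

theorem bounded_pairUp (l l' : List ι) :
    (pairUp l l' : Prog dA dB _).Bounded C l.length 0 := by
  induction l generalizing l' with
  | nil => exact Prog.bounded_pure _
  | cons x l ih =>
    cases l' with
    | nil => exact (Prog.bounded_pure _).mono (Nat.zero_le _)
    | cons y l' =>
      exact ((Prog.bounded_exec _).bind_zero fun _ => (ih l').bind_zero fun _ =>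
        Prog.bounded_pure _).mono (by simp only [Instr.cost, List.length_cons]; lia)

theorem bounded_discoverOrder [∀ i, NeZero (dA i)] [∀ j, NeZero (dB j)] (P : ∀ i, ICPOVM (dA i))
    (Q : ∀ j, ICPOVM (dB j)) (N : ℕ) (χmin : ℝ) {A B : ℕ} (hA : ∀ i, dA i ≤ A)
    (hB : ∀ j, dB j ≤ B) (h1A : 1 ≤ A) (h1B : 1 ≤ B) (hn : 1 ≤ n) (hN : A ^ 4 * B ^ 4 ≤ N) :
    (discoverOrder P Q N χmin).Bounded C (4000 * (N * n * (n + A + B ^ 4))) N := by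
  unfold discoverOrder
  have hAB : 1 ≤ A ^ 4 * B ^ 4 := Nat.one_le_iff_ne_zero.mpr (by positivity)
  have h1 : (discoverOrder P Q N χmin).Bounded C _ (N + 0) :=
    (bounded_independence (C := C) P Q N (χmin / 2) hA hB).bind fun ind =>
      (bounded_forEach_zero fun k => bounded_countFalse fun i => ind k i).bind_zero fun cA =>
      (bounded_forEach_zero fun k => bounded_countFalse fun i => ind i k).bind_zero fun cB =>
      (bounded_sortList (r := fun x y => cA y ≤ cA x) (fun x y => Prog.bounded_exec _)
        (fun x y => law_leNat C _ _)
        (List.finRange n)).bind_of_law (law_sortList C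
        (fun x y => law_leNat C _ _) _) <|
      (bounded_sortList (r := fun x y => cB x ≤ cB y) (fun x y => Prog.bounded_exec _)
        (fun x y => law_leNat C _ _)
        (List.finRange n)).bind_zero fun outputs => (bounded_pairUp _ outputs).mono
          (T' := n) (by rw [List.length_insertionSort, List.length_finRange])
  refine h1.mono ?_
  simp only [List.length_finRange]
  have hN1 : 1 ≤ N := hAB.trans hN
  -- Here the tomography of the `n²` pairs is absorbed by `hN`. All terms other than the multiples
  -- of `n A N` and `n B⁴ N` are now bounded by multiples of `n² N`, whose coefficients add up to
  -- less than 4000.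
  have e1 : n * n * (A ^ 4 * B ^ 4) ≤ n * n * N := Nat.mul_le_mul_left _ hN
  have e2 : n * n ≤ n * n * N := Nat.le_mul_of_pos_right _ hN1
  have e3 : n ≤ n * n := Nat.le_mul_of_pos_right _ hn
  have e4 : N ≤ n * n * N := Nat.le_mul_of_pos_left _ (Nat.mul_pos hn hn)
  have e5 : n * N ≤ n * n * N := Nat.mul_le_mul_right _ e3
  have e6 := Nat.zero_le (n * A * N)
  have e7 := Nat.zero_le (n * B ^ 4 * N)
  ring_nf at e1 e2 e3 e4 e5 e6 e7 ⊢
  linarith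

end Cost

/-! ### The trace norm -/

section TraceNorm

open scoped Matrix.Norms.Frobenius InnerProductSpace

theorem frobenius_norm_sq {ι κ : Type} [Fintype ι] [Fintype κ] (X : Matrix ι κ ℂ) :
    ‖X‖ ^ 2 = ∑ i, ∑ j, ‖X i j‖ ^ 2 := by
  rw [Matrix.frobenius_norm_def, ← Real.sqrt_eq_rpow, Real.sq_sqrt (by positivity)]
  simp

variable {ι : Type} [Fintype ι] [DecidableEq ι]

/-- This serves as a singular value decomposition: the images under `X` of the eigenvectors of `X†
X` are orthogonal, with squared lengths the eigenvalues. -/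
theorem inner_toEuclideanLin_eigenvectorBasis (X : Matrix ι ι ℂ) (i j : ι) :
    ⟪Matrix.toEuclideanLin X ((Matrix.isHermitian_conjTranspose_mul_self X).eigenvectorBasis i),
      Matrix.toEuclideanLin X ((Matrix.isHermitian_conjTranspose_mul_self X).eigenvectorBasis j)⟫_ℂ =
      if i = j then ((Matrix.isHermitian_conjTranspose_mul_self X).eigenvalues j : ℂ) else 0 := by
  set h := Matrix.isHermitian_conjTranspose_mul_self X
  rw [← LinearMap.adjoint_inner_right, ← Matrix.toEuclideanLin_conjTranspose_eq_adjoint]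
  have : Matrix.toEuclideanLin Xᴴ (Matrix.toEuclideanLin X (h.eigenvectorBasis j)) =
      (h.eigenvalues j : ℂ) • h.eigenvectorBasis j := by
    have := h.mulVec_eigenvectorBasis j
    apply (WithLp.ofLp_injective 2)
    simpa [Matrix.toLpLin_apply, Matrix.mulVec_mulVec] using this
  rw [this, inner_smul_right, orthonormal_iff_ite.mp h.eigenvectorBasis.orthonormal]
  split_ifs <;> simp

theorem norm_toEuclideanLin_eigenvectorBasis (X : Matrix ι ι ℂ) (i : ι) :
    ‖Matrix.toEuclideanLin X ((Matrix.isHermitian_conjTranspose_mul_self X).eigenvectorBasis i)‖ =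
      √((Matrix.isHermitian_conjTranspose_mul_self X).eigenvalues i) := by
  have h := inner_toEuclideanLin_eigenvectorBasis X i i
  rw [if_pos rfl, inner_self_eq_norm_sq_to_K] at h
  rw [← Real.sqrt_sq (norm_nonneg (Matrix.toEuclideanLin X _))]
  congr 1
  exact Complex.ofReal_injective (by simpa using h)

/-- The upper half of the variational formula for the trace norm. Expand `u j` in the right singular
vectors `w k` of `Y`. For fixed `k`, Cauchy–Schwarz over `j` and Bessel's inequality for both
families leave `‖w k‖ ‖Y w k‖`, which is the `k`-th singular value. -/
theorem sum_norm_inner_le_traceNorm {κ : Type} [Fintype κ] {e u : κ → EuclideanSpace ℂ ι}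
    (he : Orthonormal ℂ e) (hu : Orthonormal ℂ u) (Y : Matrix ι ι ℂ) :
    ∑ j, ‖⟪e j, Matrix.toEuclideanLin Y (u j)⟫_ℂ‖ ≤ traceNorm Y := by
  set w := (Matrix.isHermitian_conjTranspose_mul_self Y).eigenvectorBasis with hw
  have h1 : ∀ j, ‖⟪e j, Matrix.toEuclideanLin Y (u j)⟫_ℂ‖ ≤
      ∑ k, ‖⟪u j, w k⟫_ℂ‖ * ‖⟪e j, Matrix.toEuclideanLin Y (w k)⟫_ℂ‖ := by
    intro j
    conv_lhs => rw [← w.sum_repr' (u j), map_sum, inner_sum]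
    refine (norm_sum_le _ _).trans (Finset.sum_le_sum fun k _ => ?_)
    rw [map_smul, inner_smul_right, norm_mul, norm_inner_symm]
  calc _ ≤ ∑ j, ∑ k, ‖⟪u j, w k⟫_ℂ‖ * ‖⟪e j, Matrix.toEuclideanLin Y (w k)⟫_ℂ‖ :=
        Finset.sum_le_sum fun j _ => h1 j
    _ = ∑ k, ∑ j, ‖⟪u j, w k⟫_ℂ‖ * ‖⟪e j, Matrix.toEuclideanLin Y (w k)⟫_ℂ‖ := Finset.sum_comm
    _ ≤ ∑ k, √((Matrix.isHermitian_conjTranspose_mul_self Y).eigenvalues k) := by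
        refine Finset.sum_le_sum fun k _ => ?_
        rw [← norm_toEuclideanLin_eigenvectorBasis]
        refine (Real.sum_mul_le_sqrt_mul_sqrt _ _ _).trans ?_
        have h2 := hu.sum_inner_products_le (x := w k) (s := Finset.univ)
        have h3 := he.sum_inner_products_le (x := Matrix.toEuclideanLin Y (w k)) (s := Finset.univ)
        rw [w.norm_eq_one, one_pow] at h2
        calc _ ≤ √1 * √(‖Matrix.toEuclideanLin Y (w k)‖ ^ 2) := by gcongr
          _ = _ := by rw [Real.sqrt_one, one_mul, Real.sqrt_sq (norm_nonneg _)]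

/-- For `X = Y + Z` the variational bound is attained by the singular vectors `v i` and `e i = X v i
/ ‖X v i‖`. With these fixed the expression is subadditive, and `sum_norm_inner_le_traceNorm` bounds
the parts belonging to `Y` and `Z`. -/
theorem traceNorm_add_le (Y Z : Matrix ι ι ℂ) : traceNorm (Y + Z) ≤ traceNorm Y + traceNorm Z := by
  classical
  set X := Y + Z with hX
  set h := Matrix.isHermitian_conjTranspose_mul_self X with hh
  set v := h.eigenvectorBasis with hv
  -- Only nonzero singular values have a left singular vector of the form `X v i / ‖X v i‖`; the
  -- others add nothing to the trace norm.
  let κ := {i : ι // h.eigenvalues i ≠ 0}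
  have h0 : ∀ i, 0 ≤ h.eigenvalues i :=
    (Matrix.posSemidef_conjTranspose_mul_self X).eigenvalues_nonneg
  have hs : ∀ i : κ, (√(h.eigenvalues i.1) : ℂ) ≠ 0 := fun i =>
    Complex.ofReal_ne_zero.mpr (Real.sqrt_ne_zero (h0 _) |>.mpr i.2)
  let e : κ → EuclideanSpace ℂ ι := fun i =>
    (√(h.eigenvalues i.1) : ℂ)⁻¹ • Matrix.toEuclideanLin X (v i.1)
  have hsq : ∀ i : κ, (√(h.eigenvalues i.1) : ℂ) * √(h.eigenvalues i.1) = h.eigenvalues i.1 := by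
    intro i
    rw [← Complex.ofReal_mul, Real.mul_self_sqrt (h0 _)]
  have he : Orthonormal ℂ e := by
    rw [orthonormal_iff_ite]
    intro i j
    simp only [e, inner_smul_left, inner_smul_right, map_inv₀, Complex.conj_ofReal]
    rw [inner_toEuclideanLin_eigenvectorBasis]
    by_cases hij : i = j
    · subst hij
      rw [if_pos rfl, if_pos rfl, ← hsq]
      have := hs i
      field_simp
    · rw [if_neg (fun hc => hij (Subtype.ext hc)), if_neg hij]
      simp
  have hu : Orthonormal ℂ (fun i : κ => v i.1) := v.orthonormal.comp _ Subtype.val_injective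
  have h1 : ∀ i : κ, √(h.eigenvalues i.1) = ‖⟪e i, Matrix.toEuclideanLin X (v i.1)⟫_ℂ‖ := by
    intro i
    simp only [e, inner_smul_left, map_inv₀, Complex.conj_ofReal]
    rw [inner_toEuclideanLin_eigenvectorBasis, if_pos rfl, ← hsq, inv_mul_cancel_left₀ (hs i)]
    rw [Complex.norm_real, Real.norm_of_nonneg (Real.sqrt_nonneg _)]
  have h2 : traceNorm X = ∑ i : κ, √(h.eigenvalues i.1) := by
    rw [← Finset.sum_subtype (Finset.univ.filter fun i => h.eigenvalues i ≠ 0) (by simp)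
      fun i => √(h.eigenvalues i), Finset.sum_filter_of_ne]
    · rfl
    · intro i _ hi h0
      rw [h0, Real.sqrt_zero] at hi
      exact hi rfl
  have h3 : Matrix.toEuclideanLin X = Matrix.toEuclideanLin Y + Matrix.toEuclideanLin Z :=
    map_add _ _ _
  rw [h2]
  calc _ ≤ ∑ i : κ, (‖⟪e i, Matrix.toEuclideanLin Y (v i.1)⟫_ℂ‖ +
        ‖⟪e i, Matrix.toEuclideanLin Z (v i.1)⟫_ℂ‖) := by
        refine Finset.sum_le_sum fun i _ => ?_
        rw [h1, h3, LinearMap.add_apply, inner_add_right]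
        exact norm_add_le _ _
    _ ≤ _ := by
        rw [Finset.sum_add_distrib]
        exact add_le_add (sum_norm_inner_le_traceNorm he hu Y) (sum_norm_inner_le_traceNorm he hu Z)

/-- Cauchy–Schwarz over the singular values, whose squares sum to `Tr (X† X)`. -/
theorem traceNorm_le_frobenius (X : Matrix ι ι ℂ) :
    traceNorm X ≤ √(Fintype.card ι) * ‖X‖ := by
  set h := Matrix.isHermitian_conjTranspose_mul_self X with hh
  have h0 : ∀ i, 0 ≤ h.eigenvalues i :=
    (Matrix.posSemidef_conjTranspose_mul_self X).eigenvalues_nonneg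
  have h1 : ∑ i, h.eigenvalues i = ‖X‖ ^ 2 := by
    have := h.trace_eq_sum_eigenvalues
    rw [frobenius_norm_sq]
    apply Complex.ofReal_injective
    simp only [Complex.ofReal_sum]
    refine this.symm.trans ?_
    simp only [Matrix.trace, Matrix.diag_apply, Matrix.mul_apply, Matrix.conjTranspose_apply]
    rw [Finset.sum_comm]
    refine Finset.sum_congr rfl fun i _ => Finset.sum_congr rfl fun j _ => ?_
    rw [Complex.star_def, mul_comm, Complex.mul_conj, Complex.normSq_eq_norm_sq]
  have h2 := Real.sum_mul_le_sqrt_mul_sqrt Finset.univ (fun _ : ι => (1 : ℝ))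
    (fun i => √(h.eigenvalues i))
  simp only [one_mul, one_pow, Finset.sum_const, Finset.card_univ, nsmul_eq_mul, mul_one,
    Real.sq_sqrt (h0 _), h1, Real.sqrt_sq (norm_nonneg X)] at h2
  exact h2

theorem abs_traceNorm_sub_le (X Y : Matrix ι ι ℂ) :
    |traceNorm X - traceNorm Y| ≤ √(Fintype.card ι) * ‖X - Y‖ := by
  have h1 := traceNorm_add_le Y (X - Y)
  have h2 := traceNorm_add_le X (Y - X)
  have h3 := traceNorm_le_frobenius (X - Y)
  have h4 := traceNorm_le_frobenius (Y - X)
  rw [norm_sub_rev] at h4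
  rw [add_sub_cancel] at h1 h2
  rw [abs_le]
  constructor <;> linarith

end TraceNorm

/-! ### Stability of `χ₁` -/

section Stability

open scoped Matrix.Norms.Frobenius

variable {α β : Type} [Fintype α] [Fintype β]

/-- With `ρ = B† B`, submultiplicativity gives `‖ρ‖ ≤ ‖B‖²`, and `‖B‖² = Tr ρ`. -/
theorem frobenius_norm_le_one {ρ : Matrix α α ℂ} (h : ρ.PosSemidef) (ht : ρ.trace = 1) :
    ‖ρ‖ ≤ 1 := by
  obtain ⟨B, rfl⟩ := exists_conjTranspose_mul_self h
  refine (Matrix.frobenius_norm_mul _ _).trans ?_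
  rw [Matrix.frobenius_norm_conjTranspose, ← sq, frobenius_norm_sq]
  apply le_of_eq
  apply Complex.ofReal_injective
  rw [Complex.ofReal_one, ← ht]
  simp only [Matrix.trace, Matrix.diag_apply, Matrix.mul_apply, Matrix.conjTranspose_apply,
    Complex.ofReal_sum]
  rw [Finset.sum_comm]
  refine Finset.sum_congr rfl fun i _ => Finset.sum_congr rfl fun j _ => ?_
  rw [Complex.star_def, mul_comm, Complex.mul_conj, Complex.normSq_eq_norm_sq]

theorem frobenius_norm_kronecker (A : Matrix α α ℂ) (B : Matrix β β ℂ) :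
    ‖A ⊗ₖ B‖ = ‖A‖ * ‖B‖ := by
  rw [← sq_eq_sq₀ (norm_nonneg _) (by positivity), mul_pow, frobenius_norm_sq, frobenius_norm_sq,
    frobenius_norm_sq]
  simp only [Fintype.sum_prod_type, Matrix.kroneckerMap_apply, norm_mul, mul_pow]
  rw [Finset.sum_mul_sum]
  refine Finset.sum_congr rfl fun i _ => Finset.sum_congr rfl fun k _ => ?_
  rw [Finset.sum_mul_sum]

/-- Each entry of the partial trace is a sum of `card β` entries of `Δ`. Apply Cauchy–Schwarz, then
add the entries off-diagonal in `β`, which only enlarges the right side. -/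
theorem norm_traceRight_le (Δ : Matrix (α × β) (α × β) ℂ) :
    ‖traceRight Δ‖ ≤ √(Fintype.card β) * ‖Δ‖ := by
  rw [← Real.sqrt_sq (norm_nonneg Δ), ← Real.sqrt_mul (by positivity)]
  apply Real.le_sqrt_of_sq_le
  rw [frobenius_norm_sq, frobenius_norm_sq]
  simp only [Fintype.sum_prod_type, Finset.mul_sum, traceRight, Matrix.of_apply]
  refine Finset.sum_le_sum fun x _ => ?_
  rw [Finset.sum_comm]
  refine Finset.sum_le_sum fun x' _ => ?_
  calc _ ≤ (∑ y, ‖Δ (x, y) (x', y)‖) ^ 2 := by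
        gcongr
        exact norm_sum_le _ _
    _ ≤ Fintype.card β * ∑ y, ‖Δ (x, y) (x', y)‖ ^ 2 := by
        rw [← Finset.card_univ]
        exact sq_sum_le_card_mul_sum_sq
    _ ≤ _ := by
        rw [Finset.mul_sum]
        refine Finset.sum_le_sum fun y _ => ?_
        exact Finset.single_le_sum
          (f := fun y' => (Fintype.card β : ℝ) * ‖Δ (x, y) (x', y')‖ ^ 2)
          (fun _ _ => by positivity) (Finset.mem_univ y)

omit [Fintype β] in
theorem traceLeft_eq_traceRight (Δ : Matrix (α × β) (α × β) ℂ) :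
    traceLeft Δ = traceRight (Δ.submatrix Prod.swap Prod.swap) := rfl

theorem norm_traceLeft_le (Δ : Matrix (α × β) (α × β) ℂ) :
    ‖traceLeft Δ‖ ≤ √(Fintype.card α) * ‖Δ‖ := by
  rw [traceLeft_eq_traceRight]
  refine (norm_traceRight_le _).trans_eq ?_
  congr 1
  rw [← sq_eq_sq₀ (norm_nonneg _) (norm_nonneg _), frobenius_norm_sq, frobenius_norm_sq]
  rw [← (Equiv.prodComm β α).sum_comp]
  refine Finset.sum_congr rfl fun p _ => ?_
  rw [← (Equiv.prodComm β α).sum_comp]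
  rfl

omit [Fintype α] in
theorem traceRight_posSemidef {ρ : Matrix (α × β) (α × β) ℂ} (h : ρ.PosSemidef) :
    (traceRight ρ).PosSemidef := by
  have : traceRight ρ = ∑ y, ρ.submatrix (fun x => (x, y)) (fun x => (x, y)) := by
    ext x x'
    simp [traceRight, Matrix.sum_apply]
  rw [this]
  exact Matrix.posSemidef_sum _ fun y _ => h.submatrix _

omit [Fintype β] in
theorem traceLeft_posSemidef {ρ : Matrix (α × β) (α × β) ℂ} (h : ρ.PosSemidef) :
    (traceLeft ρ).PosSemidef := by
  rw [traceLeft_eq_traceRight]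
  exact traceRight_posSemidef (h.submatrix _)

theorem trace_traceRight (ρ : Matrix (α × β) (α × β) ℂ) : (traceRight ρ).trace = ρ.trace := by
  simp [Matrix.trace, traceRight, Fintype.sum_prod_type]

theorem trace_traceLeft (ρ : Matrix (α × β) (α × β) ℂ) : (traceLeft ρ).trace = ρ.trace := by
  simp only [Matrix.trace, traceLeft, Fintype.sum_prod_type, Matrix.diag_apply, Matrix.of_apply]
  exact Finset.sum_comm

omit [Fintype α] in
theorem traceRight_sub (ρ ρ' : Matrix (α × β) (α × β) ℂ) :
    traceRight (ρ - ρ') = traceRight ρ - traceRight ρ' := by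
  ext x x'
  simp [traceRight]

omit [Fintype β] in
theorem traceLeft_sub (ρ ρ' : Matrix (α × β) (α × β) ℂ) :
    traceLeft (ρ - ρ') = traceLeft ρ - traceLeft ρ' := by
  ext x x'
  simp [traceLeft]

variable [DecidableEq α] [DecidableEq β]

theorem chiOne_le {ρ : Matrix (α × β) (α × β) ℂ} (h : ρ.PosSemidef) (ht : ρ.trace = 1) :
    chiOne ρ ≤ 2 * √(Fintype.card α * Fintype.card β) := by
  refine (traceNorm_le_frobenius _).trans ?_
  rw [Fintype.card_prod, Nat.cast_mul, mul_comm]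
  gcongr
  refine (norm_sub_le _ _).trans ?_
  rw [frobenius_norm_kronecker]
  have h1 := frobenius_norm_le_one h ht
  have h2 := frobenius_norm_le_one (traceRight_posSemidef h) ((trace_traceRight ρ).trans ht)
  have h3 := frobenius_norm_le_one (traceLeft_posSemidef h) ((trace_traceLeft ρ).trans ht)
  nlinarith [norm_nonneg (traceRight ρ), norm_nonneg (traceLeft ρ)]

/-- Only `ρ` has to be a state: an estimate `ρ'` may be neither positive nor normalised. With `s² =
card α` and `t² = card β`, the change of `ρ - ρ_A ⊗ ρ_B` has Frobenius norm at most `ε + t ε + s ε +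
s t ε²`. The assumption `ε ≤ 1` makes the last term linear, and each of the four is at most `s t ε`.
Passing to the trace norm costs another factor `s t`. -/
theorem abs_chiOne_sub_le [Nonempty α] [Nonempty β] {ρ ρ' : Matrix (α × β) (α × β) ℂ}
    (h : ρ.PosSemidef) (ht : ρ.trace = 1) {ε : ℝ} (hε : ‖ρ' - ρ‖ ≤ ε) (hε1 : ε ≤ 1) :
    |chiOne ρ' - chiOne ρ| ≤ 4 * (Fintype.card α * Fintype.card β) * ε := by
  refine (abs_traceNorm_sub_le _ _).trans ?_
  set Δ := ρ' - ρ with hΔ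
  have e : ρ' - traceRight ρ' ⊗ₖ traceLeft ρ' - (ρ - traceRight ρ ⊗ₖ traceLeft ρ) =
      Δ - (traceRight Δ ⊗ₖ traceLeft ρ + (traceRight ρ + traceRight Δ) ⊗ₖ traceLeft Δ) := by
    rw [hΔ, traceRight_sub, traceLeft_sub]
    ext p q
    simp only [Matrix.sub_apply, Matrix.add_apply, Matrix.kroneckerMap_apply]
    ring
  rw [e]
  have h2 := frobenius_norm_le_one (traceRight_posSemidef h) ((trace_traceRight ρ).trans ht)
  have h3 := frobenius_norm_le_one (traceLeft_posSemidef h) ((trace_traceLeft ρ).trans ht)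
  have h4 := norm_traceRight_le Δ
  have h5 := norm_traceLeft_le Δ
  rw [Fintype.card_prod, Nat.cast_mul, Real.sqrt_mul (by positivity)]
  set s := √(Fintype.card α) with hs
  set t := √(Fintype.card β) with ht
  have hs2 : (Fintype.card α : ℝ) = s ^ 2 := (Real.sq_sqrt (by positivity)).symm
  have ht2 : (Fintype.card β : ℝ) = t ^ 2 := (Real.sq_sqrt (by positivity)).symm
  have hs1 : 1 ≤ s := Real.one_le_sqrt.mpr (by exact_mod_cast Fintype.card_pos)
  have ht1 : 1 ≤ t := Real.one_le_sqrt.mpr (by exact_mod_cast Fintype.card_pos)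
  have h0 : 0 ≤ ε := (norm_nonneg _).trans hε
  have h6 : ‖Δ - (traceRight Δ ⊗ₖ traceLeft ρ + (traceRight ρ + traceRight Δ) ⊗ₖ traceLeft Δ)‖ ≤
      ε + (t * ε * 1 + (1 + t * ε) * (s * ε)) := by
    refine (norm_sub_le _ _).trans (add_le_add hε ((norm_add_le _ _).trans ?_))
    rw [frobenius_norm_kronecker, frobenius_norm_kronecker]
    have h7 : ‖traceRight Δ‖ ≤ t * ε := h4.trans (by gcongr)
    have h8 : ‖traceLeft Δ‖ ≤ s * ε := h5.trans (by gcongr)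
    have h9 : ‖traceRight ρ + traceRight Δ‖ ≤ 1 + t * ε :=
      (norm_add_le _ _).trans (add_le_add h2 h7)
    gcongr
  have hst : 1 ≤ s * t := by nlinarith
  have h10 : ε + (t * ε * 1 + (1 + t * ε) * (s * ε)) ≤ 4 * (s * t) * ε := by
    have a1 : t * ε ≤ s * t * ε := by
      nlinarith [mul_nonneg (sub_nonneg.mpr hs1) (mul_nonneg (zero_le_one.trans ht1) h0)]
    have a2 : s * ε ≤ s * t * ε := by
      nlinarith [mul_nonneg (sub_nonneg.mpr ht1) (mul_nonneg (zero_le_one.trans hs1) h0)]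
    have a3 : ε ≤ s * t * ε := by nlinarith
    have a4 : t * ε * (s * ε) ≤ s * t * ε := by
      nlinarith [mul_nonneg (mul_nonneg (zero_le_one.trans hst) h0)
        (sub_nonneg.mpr hε1)]
    nlinarith
  calc _ ≤ s * t * (4 * (s * t) * ε) := by gcongr; exact h6.trans h10
    _ = _ := by rw [hs2, ht2]; ring

end Stability

/-! ### Linear inversion -/

section Inversion

open scoped Matrix.Norms.Frobenius InnerProductSpace

variable {d m : ℕ}

/-- The operator `S = ∑ α, |α⟩⟪P α|`. -/
noncomputable def analysisOp (P : POVM d m) : Matrix (Fin m) (Fin d × Fin d) ℂ :=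
  Matrix.of fun α p => star (vectorize (P.elem α) p)

theorem frameOp_eq (P : POVM d m) : frameOp P = (analysisOp P)ᴴ * analysisOp P := by
  ext p q
  simp [frameOp, analysisOp, Matrix.sum_apply, Matrix.mul_apply, Matrix.vecMulVec_apply]

/-- As `F = S† S`, it suffices that `S` is injective. A vector in its kernel defines a linear
functional that vanishes on every `P_α`, hence on their span, which is everything. -/
theorem frameOp_posDef (P : ICPOVM d) : (frameOp P.toPOVM).PosDef := by
  rw [frameOp_eq]
  refine Matrix.PosDef.conjTranspose_mul_self _ ?_
  rw [← Matrix.coe_mulVecLin, injective_iff_map_eq_zero]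
  intro v hv
  let ℓ : Matrix (Fin d) (Fin d) ℂ →ₗ[ℂ] ℂ :=
    ∑ p : Fin d × Fin d, star (v p) • (Matrix.entryLinearMap ℂ ℂ p.1 p.2)
  have hℓ : ∀ X, ℓ X = ∑ p : Fin d × Fin d, star (v p) * X p.1 p.2 := by
    intro X
    simp [ℓ]
  have h0 : ℓ = 0 := by
    refine LinearMap.ext_on_range P.span_eq_top fun α => ?_
    rw [hℓ]
    have := congrArg star (congrFun hv α)
    simp only [Matrix.mulVecLin_apply, Matrix.mulVec, dotProduct, analysisOp, Matrix.of_apply,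
      star_sum, star_mul', star_star, Pi.zero_apply, star_zero] at this
    rw [LinearMap.zero_apply, ← this]
    exact Finset.sum_congr rfl fun p _ => mul_comm _ _
  have h1 := hℓ (Matrix.of fun i j => v (i, j))
  rw [h0, LinearMap.zero_apply] at h1
  have h2 : dotProduct (star v) v = 0 := h1.symm
  exact dotProduct_star_self_eq_zero.mp h2

theorem frameLambdaMin_pos [NeZero d] (P : ICPOVM d) : 0 < frameLambdaMin P.toPOVM := by
  obtain ⟨p, hp⟩ := exists_eq_ciInf_of_finite
    (f := (frameOp_isHermitian P.toPOVM).eigenvalues)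
  rw [frameLambdaMin, ← hp]
  exact (frameOp_posDef P).eigenvalues_pos p

/-- The Rayleigh quotient bound, from the expansion of `z` in an eigenbasis of the frame operator.
-/
theorem frameLambdaMin_mul_le (P : POVM d m) (z : EuclideanSpace ℂ (Fin d × Fin d)) :
    frameLambdaMin P * ‖z‖ ^ 2 ≤ RCLike.re ⟪z, Matrix.toEuclideanLin (frameOp P) z⟫_ℂ := by
  set h := frameOp_isHermitian P
  set w := h.eigenvectorBasis with hw
  have h1 : ∀ i, Matrix.toEuclideanLin (frameOp P) (w i) = (h.eigenvalues i : ℂ) • w i := by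
    intro i
    have := h.mulVec_eigenvectorBasis i
    apply (WithLp.ofLp_injective 2)
    simpa [Matrix.toLpLin_apply] using this
  have h2 : ⟪z, Matrix.toEuclideanLin (frameOp P) z⟫_ℂ =
      ∑ i, ((h.eigenvalues i * ‖⟪w i, z⟫_ℂ‖ ^ 2 : ℝ) : ℂ) := by
    rw [← w.sum_inner_mul_inner]
    refine Finset.sum_congr rfl fun i _ => ?_
    rw [← LinearMap.adjoint_inner_left, ← Matrix.toEuclideanLin_conjTranspose_eq_adjoint, h.eq, h1,
      inner_smul_left, Complex.conj_ofReal, ← inner_conj_symm z (w i), Complex.ofReal_mul,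
      ← Complex.normSq_eq_norm_sq, Complex.normSq_eq_conj_mul_self]
    ring
  rw [h2, map_sum, ← w.sum_sq_norm_inner_right z, Finset.mul_sum]
  refine Finset.sum_le_sum fun i _ => ?_
  rw [RCLike.re_eq_complex_re, Complex.ofReal_re]
  gcongr
  exact ciInf_le (Set.finite_range _).bddBelow i

/-- The synthesis operator `F⁻¹ S†`, the left inverse of `S`. -/
noncomputable def inversionOp (P : POVM d m) : Matrix (Fin d × Fin d) (Fin m) ℂ :=
  (frameOp P)⁻¹ * (analysisOp P)ᴴ

theorem inversionOp_mul_analysisOp (P : ICPOVM d) :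
    inversionOp P.toPOVM * analysisOp P.toPOVM = 1 := by
  rw [inversionOp, Matrix.mul_assoc, ← frameOp_eq]
  exact Matrix.nonsing_inv_mul _ ((Matrix.isUnit_iff_isUnit_det _).mp (frameOp_posDef P).isUnit)

/-- The norm of `F⁻¹ S†` is at most `λ^(-1/2)`, not merely `λ⁻¹ ‖S‖`. For `z = F⁻¹ S† v` one has `‖S
z‖² = ⟪z, F z⟫ = ⟪S z, v⟫`, so `‖S z‖ ≤ ‖v‖`, while `λ ‖z‖² ≤ ⟪z, F z⟫`. -/
theorem frameLambdaMin_mul_inversionOp_mulVec (P : ICPOVM d) (v : EuclideanSpace ℂ (Fin (d ^ 2))) :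
    frameLambdaMin P.toPOVM * ‖Matrix.toEuclideanLin (inversionOp P.toPOVM) v‖ ^ 2 ≤ ‖v‖ ^ 2 := by
  set z := Matrix.toEuclideanLin (inversionOp P.toPOVM) v with hz
  refine (frameLambdaMin_mul_le _ z).trans ?_
  have h1 : Matrix.toEuclideanLin (frameOp P.toPOVM) z =
      Matrix.toEuclideanLin (analysisOp P.toPOVM)ᴴ v := by
    apply (WithLp.ofLp_injective 2)
    rw [hz]
    simp only [Matrix.toLpLin_apply, Matrix.mulVec_mulVec]
    rw [inversionOp, ← Matrix.mul_assoc, Matrix.mul_nonsing_inv _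
      ((Matrix.isUnit_iff_isUnit_det _).mp (frameOp_posDef P).isUnit), Matrix.one_mul]
  have h2 : Matrix.toEuclideanLin (frameOp P.toPOVM) z = Matrix.toEuclideanLin
      (analysisOp P.toPOVM)ᴴ (Matrix.toEuclideanLin (analysisOp P.toPOVM) z) := by
    apply (WithLp.ofLp_injective 2)
    simp only [Matrix.toLpLin_apply, Matrix.mulVec_mulVec, frameOp_eq]
  set y := Matrix.toEuclideanLin (analysisOp P.toPOVM) z
  have h3 : RCLike.re ⟪z, Matrix.toEuclideanLin (frameOp P.toPOVM) z⟫_ℂ = ‖y‖ ^ 2 := by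
    rw [h2, Matrix.toEuclideanLin_conjTranspose_eq_adjoint, LinearMap.adjoint_inner_right,
      inner_self_eq_norm_sq]
  have h4 : RCLike.re ⟪z, Matrix.toEuclideanLin (frameOp P.toPOVM) z⟫_ℂ ≤ ‖y‖ * ‖v‖ := by
    rw [h1, Matrix.toEuclideanLin_conjTranspose_eq_adjoint, LinearMap.adjoint_inner_right]
    exact re_inner_le_norm _ _
  rw [h3] at h4 ⊢
  have h5 : ‖y‖ ≤ ‖v‖ := by
    by_contra hc
    push Not at hc
    nlinarith [norm_nonneg v]
  gcongr

theorem frameLambdaMin_mul_inversionOp_mul {κ : Type} [Fintype κ] (P : ICPOVM d)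
    (V : Matrix (Fin (d ^ 2)) κ ℂ) :
    frameLambdaMin P.toPOVM * ‖inversionOp P.toPOVM * V‖ ^ 2 ≤ ‖V‖ ^ 2 := by
  rw [frobenius_norm_sq, frobenius_norm_sq, Finset.sum_comm,
    Finset.sum_comm (f := fun i j => ‖V i j‖ ^ 2), Finset.mul_sum]
  refine Finset.sum_le_sum fun k _ => ?_
  have := frameLambdaMin_mul_inversionOp_mulVec P (WithLp.toLp 2 fun i => V i k)
  rw [EuclideanSpace.norm_sq_eq, EuclideanSpace.norm_sq_eq] at this
  exact this

/-- The exchange of the second and the third index. -/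
def realign {α β γ δ : Type} (M : Matrix (α × β) (γ × δ) ℂ) : Matrix (α × γ) (β × δ) ℂ :=
  Matrix.of fun s t => M (s.1, t.1) (s.2, t.2)

theorem norm_realign {α β γ δ : Type} [Fintype α] [Fintype β] [Fintype γ] [Fintype δ]
    (M : Matrix (α × β) (γ × δ) ℂ) : ‖realign M‖ = ‖M‖ := by
  rw [← sq_eq_sq₀ (norm_nonneg _) (norm_nonneg _), frobenius_norm_sq, frobenius_norm_sq]
  simp only [Fintype.sum_prod_type, realign, Matrix.of_apply]
  exact Finset.sum_congr rfl fun x _ => Finset.sum_comm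

variable {a b : ℕ}

/-- After realignment, vectorised tensor products act as multiplication from the left on the indices
of `A` and from the right on those of `B`, so the two inversions can be estimated one at a time. -/
theorem reconstructed_eq (P : ICPOVM a) (Q : ICPOVM b) (p : Matrix (Fin (a ^ 2)) (Fin (b ^ 2)) ℂ) :
    reconstructed P Q p = realign (inversionOp P.toPOVM * p * (inversionOp Q.toPOVM)ᵀ) := by
  have hW : ∀ q r, ((analysisOp P.toPOVM)ᴴ * p * ((analysisOp Q.toPOVM)ᴴ)ᵀ) q r =
      ∑ α, ∑ β, vectorize (P.elem α) q * vectorize (Q.elem β) r * p α β := by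
    intro q r
    simp only [Matrix.mul_apply, Matrix.transpose_apply, analysisOp, Matrix.conjTranspose_apply,
      star_star, Matrix.of_apply, Finset.sum_mul]
    rw [Finset.sum_comm]
    refine Finset.sum_congr rfl fun α _ => Finset.sum_congr rfl fun β _ => ?_
    ring
  have e : inversionOp P.toPOVM * p * (inversionOp Q.toPOVM)ᵀ = (frameOp P.toPOVM)⁻¹ *
      ((analysisOp P.toPOVM)ᴴ * p * ((analysisOp Q.toPOVM)ᴴ)ᵀ) * ((frameOp Q.toPOVM)⁻¹)ᵀ := by
    simp only [inversionOp, Matrix.transpose_mul, Matrix.mul_assoc]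
  rw [e]
  ext s t
  simp only [reconstructed, realign, Matrix.of_apply, ← hW]
  generalize (analysisOp P.toPOVM)ᴴ * p * ((analysisOp Q.toPOVM)ᴴ)ᵀ = W
  calc _ = ∑ q : Fin a × Fin a, ∑ r : Fin b × Fin b,
        (frameOp P.toPOVM)⁻¹ (s.1, t.1) q * (frameOp Q.toPOVM)⁻¹ (s.2, t.2) r * W q r := by
        simp only [Fintype.sum_prod_type]
    _ = _ := by
        simp only [Matrix.mul_apply, Matrix.transpose_apply, Finset.sum_mul]
        rw [Finset.sum_comm]
        refine Finset.sum_congr rfl fun r _ => Finset.sum_congr rfl fun q _ => ?_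
        ring

/-- The probabilities of the outcomes of the POVM `{P α ⊗ Q β}` in the state `ρ`. -/
noncomputable def pairProb (P : ICPOVM a) (Q : ICPOVM b)
    (ρ : Matrix (Fin a × Fin b) (Fin a × Fin b) ℂ) : Matrix (Fin (a ^ 2)) (Fin (b ^ 2)) ℂ :=
  analysisOp P.toPOVM * realign ρ * (analysisOp Q.toPOVM)ᵀ

theorem reconstructed_pairProb (P : ICPOVM a) (Q : ICPOVM b)
    (ρ : Matrix (Fin a × Fin b) (Fin a × Fin b) ℂ) :
    reconstructed P Q (pairProb P Q ρ) = ρ := by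
  rw [reconstructed_eq, pairProb, Matrix.mul_assoc, Matrix.mul_assoc, Matrix.mul_assoc,
    ← Matrix.transpose_mul, inversionOp_mul_analysisOp, ← Matrix.mul_assoc,
    inversionOp_mul_analysisOp, Matrix.one_mul, Matrix.transpose_one, Matrix.mul_one]
  rfl

/-- Reconstruction is linear and exact on `pairProb`, so only the error of `p` is inverted. Each of
the two sides contributes a factor `lam^(-1/2)`. -/
theorem norm_reconstructed_sub_le (P : ICPOVM a) (Q : ICPOVM b)
    (p : Matrix (Fin (a ^ 2)) (Fin (b ^ 2)) ℂ) (ρ : Matrix (Fin a × Fin b) (Fin a × Fin b) ℂ)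
    {lam : ℝ} (h0 : 0 < lam) (hP : lam ≤ frameLambdaMin P.toPOVM)
    (hQ : lam ≤ frameLambdaMin Q.toPOVM) :
    ‖reconstructed P Q p - ρ‖ ≤ lam⁻¹ * ‖p - pairProb P Q ρ‖ := by
  have h1 : reconstructed P Q p - ρ =
      realign (inversionOp P.toPOVM * (p - pairProb P Q ρ) * (inversionOp Q.toPOVM)ᵀ) := by
    rw [Matrix.mul_sub, Matrix.sub_mul]
    conv_lhs => rw [← reconstructed_pairProb P Q ρ, reconstructed_eq, reconstructed_eq]
    rfl
  rw [h1, norm_realign, Matrix.mul_assoc]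
  set V := p - pairProb P Q ρ
  have h2 := frameLambdaMin_mul_inversionOp_mul P (V * (inversionOp Q.toPOVM)ᵀ)
  have h3 := frameLambdaMin_mul_inversionOp_mul Q Vᵀ
  rw [← Matrix.frobenius_norm_transpose, Matrix.transpose_mul, Matrix.transpose_transpose,
    Matrix.frobenius_norm_transpose] at h3
  have h4 : lam ^ 2 * ‖inversionOp P.toPOVM * (V * (inversionOp Q.toPOVM)ᵀ)‖ ^ 2 ≤ ‖V‖ ^ 2 := by
    calc _ = lam * (lam * ‖inversionOp P.toPOVM * (V * (inversionOp Q.toPOVM)ᵀ)‖ ^ 2) := by ring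
      _ ≤ lam * ‖V * (inversionOp Q.toPOVM)ᵀ‖ ^ 2 := by
        gcongr
        exact le_trans (by gcongr) h2
      _ ≤ _ := le_trans (by gcongr) h3
  rw [← mul_pow] at h4
  have h5 := (pow_le_pow_iff_left₀ (by positivity) (norm_nonneg _) two_ne_zero).mp h4
  rw [le_inv_mul_iff₀ h0]
  exact h5

theorem norm_le_mul_of_entry_le {κ μ : ℕ} (V : Matrix (Fin (κ ^ 2)) (Fin (μ ^ 2)) ℂ) {t : ℝ}
    (ht : 0 ≤ t) (h : ∀ i j, ‖V i j‖ ≤ t) : ‖V‖ ≤ κ * μ * t := by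
  refine (pow_le_pow_iff_left₀ (norm_nonneg _) (by positivity) two_ne_zero).mp ?_
  rw [frobenius_norm_sq]
  calc _ ≤ ∑ _i : Fin (κ ^ 2), ∑ _j : Fin (μ ^ 2), t ^ 2 := by
        gcongr with i _ j _
        exact h i j
    _ = _ := by simp; ring

/-- The frame operator of a POVM has trace at most `d`. -/
theorem frameLambdaMin_mul_dim_le_one [NeZero d] (P : POVM d m) : frameLambdaMin P * d ≤ 1 := by
  have hd : (0 : ℝ) < d := Nat.cast_pos.mpr (NeZero.pos d)
  set h := frameOp_isHermitian P
  have h1 : ∀ α, (∑ p, vectorize (P.elem α) p * star (vectorize (P.elem α) p)) =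
      (P.elem α * P.elem α).trace := by
    intro α
    rw [Fintype.sum_prod_type]
    simp only [Matrix.trace, Matrix.diag_apply, Matrix.mul_apply, vectorize]
    refine Finset.sum_congr rfl fun x _ => Finset.sum_congr rfl fun y _ => ?_
    rw [(P.posSemidef α).1.apply]
  have h2 : ∑ p, h.eigenvalues p = ∑ α, (P.elem α * P.elem α).trace.re := by
    have := congrArg Complex.re h.trace_eq_sum_eigenvalues
    rw [Complex.re_sum] at this
    refine Eq.trans ?_ (this.symm.trans ?_)
    · exact Finset.sum_congr rfl fun p _ => (Complex.ofReal_re _).symm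
    · rw [frameOp, Matrix.trace_sum, Complex.re_sum]
      refine Finset.sum_congr rfl fun α _ => ?_
      rw [← h1]
      rfl
  have h3 : ∑ p, h.eigenvalues p ≤ d := by
    have hsum : ∑ α, (P.elem α).trace.re = d := by
      rw [← Complex.re_sum, ← Matrix.trace_sum, P.sum_eq_one, Matrix.trace_one]
      simp
    rw [h2, ← hsum]
    refine Finset.sum_le_sum fun α _ => ?_
    -- From `P_α ≤ 1` follows `Tr P_α² ≤ Tr P_α`, and these traces sum to `d`.
    have h4 : (1 - P.elem α).PosSemidef := by
      classical
      rw [← P.sum_eq_one, ← Finset.add_sum_erase _ _ (Finset.mem_univ α), add_sub_cancel_left]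
      exact Matrix.posSemidef_sum _ fun β _ => P.posSemidef β
    have := trace_mul_re_nonneg (P.posSemidef α) h4
    rw [Matrix.mul_sub, Matrix.mul_one, Matrix.trace_sub, Complex.sub_re] at this
    linarith
  -- The frame operator has `d²` eigenvalues, each at least the minimum.
  have h5 : frameLambdaMin P * (d * d) ≤ d := by
    refine le_trans ?_ h3
    have := Finset.card_nsmul_le_sum Finset.univ h.eigenvalues (frameLambdaMin P)
      fun p _ => ciInf_le (Set.finite_range _).bddBelow p
    simp only [Finset.card_univ, Fintype.card_prod, Fintype.card_fin, nsmul_eq_mul,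
      Nat.cast_mul] at this
    linarith
  by_contra hc
  push Not at hc
  nlinarith

end Inversion

/-! ### The Choi state and its marginals are states -/

section Choi

/-- Complete positivity is applied, with an ancilla of the dimension of the input, to the projector
on the unnormalised maximally entangled vector `v`. -/
theorem choi_posSemidef {a b : Type} [Fintype a] [DecidableEq a] [Fintype b] (C : Channel a b) :
    (choi C).PosSemidef := by
  let e := Fintype.equivFin a
  let v : Fin (Fintype.card a) × a → ℂ := fun p => if e p.2 = p.1 then 1 else 0
  have h1 := C.completelyPositive _ _ (Matrix.posSemidef_vecMulVec_self_star v)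
  have h2 := (h1.submatrix (fun p : a × b => (e p.1, p.2))).smul
    (inv_nonneg.mpr (Nat.cast_nonneg (Fintype.card a)) : (0 : ℝ) ≤ (Fintype.card a : ℝ)⁻¹)
  convert h2 using 1
  ext p q
  have h3 : Matrix.single p.1 q.1 (1 : ℂ) =
      Matrix.of fun s t => Matrix.vecMulVec v (star v) (e p.1, s) (e q.1, t) := by
    ext s t
    simp only [Matrix.single_apply, Matrix.of_apply, Matrix.vecMulVec_apply, v, Pi.star_apply,
      e.apply_eq_iff_eq]
    by_cases h3 : s = p.1 <;> by_cases h4 : t = q.1 <;> simp [h3, h4, eq_comm]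
  simp only [choi, Matrix.of_apply, Matrix.smul_apply, Matrix.submatrix_apply, ampliate,
    Complex.real_smul, Complex.ofReal_inv, Complex.ofReal_natCast, h3]

theorem choi_trace {a b : Type} [Fintype a] [DecidableEq a] [Nonempty a] [Fintype b]
    (C : Channel a b) : (choi C).trace = 1 := by
  have h : ∀ x : a, ∑ y, C.map (Matrix.single x x 1) y y = 1 := fun x => by
    have := C.trace_map (Matrix.single x x 1)
    rwa [Matrix.trace_single_eq_same] at this
  simp only [Matrix.trace, Matrix.diag_apply, choi, Matrix.of_apply, Fintype.sum_prod_type,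
    ← Finset.mul_sum, h]
  simp

variable {n : ℕ} {dA dB : Fin n → ℕ}

/-- The configurations of the other wires are represented by those `f` with `f i = 0`, an arbitrary
choice. The range of summation no longer depends on `x`, so that a marginal becomes a sum of
principal submatrices. -/
theorem sum_ite_eq_sum_update {d : Fin n → ℕ} [∀ i, NeZero (d i)] {M : Type} [AddCommMonoid M]
    (i : Fin n) (x : Fin (d i)) (F : Joint d → M) :
    (∑ f, if f i = x then F f else 0) =
      ∑ f ∈ Finset.univ.filter (fun f : Joint d => f i = 0), F (Function.update f i x) := by
  rw [← Finset.sum_filter]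
  refine Finset.sum_nbij' (fun f => Function.update f i 0) (fun f => Function.update f i x)
    ?_ ?_ ?_ ?_ ?_
  · intro f _
    simp
  · intro f _
    simp
  · intro f hf
    rw [Finset.mem_filter] at hf
    simp [← hf.2]
  · intro f hf
    rw [Finset.mem_filter] at hf
    simp [← hf.2]
  · intro f hf
    rw [Finset.mem_filter] at hf
    simp [← hf.2]

theorem choiMarginal_posSemidef [∀ i, NeZero (dA i)] [∀ j, NeZero (dB j)]
    (C : Channel (Joint dA) (Joint dB)) (i j : Fin n) : (choiMarginal C i j).PosSemidef := by
  have : choiMarginal C i j =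
      ∑ f ∈ Finset.univ.filter (fun f : Joint dA => f i = 0),
      ∑ g ∈ Finset.univ.filter (fun g : Joint dB => g j = 0),
        (choi C).submatrix (fun p : Fin (dA i) × Fin (dB j) =>
          (Function.update f i p.1, Function.update g j p.2))
          (fun p => (Function.update f i p.1, Function.update g j p.2)) := by
    ext p q
    simp only [choiMarginal, Matrix.of_apply, Matrix.sum_apply, Matrix.submatrix_apply]
    have h1 : ∀ f : Joint dA, (∑ g : Joint dB, if f i = p.1 ∧ g j = p.2 then
        choi C (f, g) (Function.update f i q.1, Function.update g j q.2) else 0) =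
        if f i = p.1 then ∑ g : Joint dB, (if g j = p.2 then
        choi C (f, g) (Function.update f i q.1, Function.update g j q.2) else 0) else 0 := by
      intro f
      by_cases hf : f i = p.1 <;> simp [hf]
    simp only [h1]
    rw [sum_ite_eq_sum_update]
    refine Finset.sum_congr rfl fun f _ => ?_
    rw [sum_ite_eq_sum_update]
    simp
  rw [this]
  exact Matrix.posSemidef_sum _ fun f _ => Matrix.posSemidef_sum _ fun g _ =>
    (choi_posSemidef C).submatrix _

theorem choiMarginal_trace [∀ i, NeZero (dA i)]
    (C : Channel (Joint dA) (Joint dB)) (i j : Fin n) : (choiMarginal C i j).trace = 1 := by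
  rw [← choi_trace C]
  simp only [Matrix.trace, Matrix.diag_apply, choiMarginal, Matrix.of_apply]
  rw [Finset.sum_comm, Fintype.sum_prod_type]
  refine Finset.sum_congr rfl fun f _ => ?_
  rw [Finset.sum_comm]
  refine Finset.sum_congr rfl fun g _ => ?_
  rw [Finset.sum_eq_single (f i, g j)]
  · simp
  · rintro ⟨x, y⟩ _ h
    rw [if_neg]
    rintro ⟨rfl, rfl⟩
    exact h rfl
  · simp

end Choi

/-! ### The distribution of the outcomes of one use of the channel -/

section Sampling

variable {n : ℕ} {dA dB : Fin n → ℕ}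

/-- The constraint is moved into the `j`-th factor: `X` replaces the elements there by zero unless
the outcome is `β`. The sum is then unconstrained and factorises. -/
theorem sum_ite_tensorOp {d m : Fin n → ℕ}
    (Y : ∀ j, Fin (m j) → Matrix (Fin (d j)) (Fin (d j)) ℂ) (j : Fin n) (β : Fin (m j)) :
    (∑ b : Joint m, if b j = β then tensorOp (fun l => Y l (b l)) else 0) =
      tensorOp (Function.update (fun l => ∑ b', Y l b') j (Y j β)) := by
  let X : ∀ l, Fin (m l) → Matrix (Fin (d l)) (Fin (d l)) ℂ :=
    Function.update Y j fun b' => if b' = β then Y j β else 0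
  have h1 : Function.update (fun l => ∑ b', Y l b') j (Y j β) = fun l => ∑ b', X l b' := by
    funext l
    rcases eq_or_ne l j with rfl | h
    · simp [X]
    · simp [X, h]
  rw [h1, ← sum_tensorOp X]
  refine Finset.sum_congr rfl fun b _ => ?_
  by_cases hb : b j = β
  · rw [if_pos hb]
    congr 1
    funext l
    rcases eq_or_ne l j with rfl | h
    · simp [X, hb]
    · simp [X, h]
  · rw [if_neg hb]
    ext f g
    simp only [tensorOp, Matrix.of_apply, Matrix.zero_apply]
    exact (Finset.prod_eq_zero (Finset.mem_univ j) (by simp [X, hb])).symm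

/-- The identity factors vanish unless `f'` agrees with `f` away from `i`; this is how the remaining
wires get traced out. -/
theorem sum_tensorOp_update_one_mul {d : Fin n → ℕ} (i : Fin n)
    (X : Matrix (Fin (d i)) (Fin (d i)) ℂ) (f : Joint d) (G : Joint d → ℂ) :
    ∑ f', tensorOp (Function.update (fun _ => 1) i X) f f' * G f' =
      ∑ x', X (f i) x' * G (Function.update f i x') := by
  have h1 : ∀ x', tensorOp (Function.update (fun _ => 1) i X) f (Function.update f i x') =
      X (f i) x' := by
    intro x'
    simp only [tensorOp, Matrix.of_apply]
    rw [Finset.prod_eq_single i]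
    · simp
    · intro k _ hk
      simp [hk]
    · simp
  have h2 : ∀ f', (∀ x', Function.update f i x' ≠ f') →
      tensorOp (Function.update (fun _ => 1) i X) f f' = 0 := by
    intro f' hf
    have : ∃ k, k ≠ i ∧ f k ≠ f' k := by
      by_contra hc
      push Not at hc
      refine hf (f' i) (funext fun k => ?_)
      rcases eq_or_ne k i with rfl | h
      · simp
      · simp [h, hc k h]
    obtain ⟨k, hk, hne⟩ := this
    exact Finset.prod_eq_zero (Finset.mem_univ k) (by simp [hk, hne])
  simp only [← h1]
  symm
  refine Finset.sum_of_injOn (fun x' => Function.update f i x') ?_ (by simp) ?_ (fun _ _ => rfl)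
  · intro x _ y _ hxy
    have := congrFun hxy i
    simpa using this
  · intro f' _ hf'
    rw [h2, zero_mul]
    intro x' hx'
    exact hf' ⟨x', by simp, hx'⟩

theorem Channel.map_apply_eq_sum {a b : Type} [Fintype a] [DecidableEq a] [Fintype b]
    (C : Channel a b) (X : Matrix a a ℂ) (u v : b) :
    C.map X u v = ∑ s, ∑ t, X s t * C.map (Matrix.single s t 1) u v := by
  conv_lhs => rw [Matrix.matrix_eq_sum_single X]
  simp only [map_sum, Matrix.sum_apply]
  refine Finset.sum_congr rfl fun s _ => Finset.sum_congr rfl fun t _ => ?_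
  rw [show Matrix.single s t (X s t) = X s t • Matrix.single s t (1 : ℂ) by
    rw [Matrix.smul_single, smul_eq_mul, mul_one], map_smul, Matrix.smul_apply, smul_eq_mul]

theorem tensorOp_transpose {d : Fin n → ℕ} (X : ∀ i, Matrix (Fin (d i)) (Fin (d i)) ℂ) :
    (tensorOp X)ᵀ = tensorOp fun i => (X i)ᵀ := rfl

theorem tensorOp_update_one_apply_swap {d : Fin n → ℕ} (j : Fin n)
    (X : Matrix (Fin (d j)) (Fin (d j)) ℂ) (g g' : Joint d) :
    tensorOp (Function.update (fun _ => 1) j X) g' g =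
      tensorOp (Function.update (fun _ => 1) j Xᵀ) g g' := by
  rw [← Matrix.transpose_apply (tensorOp _), tensorOp_transpose]
  congr 1
  funext l
  rcases eq_or_ne l j with rfl | h
  · simp
  · simp [h]

/-- The rows of `S` contain complex conjugates, which for Hermitian elements are transposes. -/
theorem pairProb_apply {a b : ℕ} (P : ICPOVM a) (Q : ICPOVM b)
    (ρ : Matrix (Fin a × Fin b) (Fin a × Fin b) ℂ) (α : Fin (a ^ 2)) (β : Fin (b ^ 2)) :
    pairProb P Q ρ α β = ∑ x, ∑ y, ∑ x', ∑ y',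
      (P.elem α)ᵀ x x' * ((Q.elem β)ᵀ y y' * ρ (x, y) (x', y')) := by
  have hP : ∀ x x', star ((P.elem α) x x') = (P.elem α) x' x :=
    fun x x' => (P.posSemidef α).1.apply x' x
  have hQ : ∀ x x', star ((Q.elem β) x x') = (Q.elem β) x' x :=
    fun y y' => (Q.posSemidef β).1.apply y' y
  simp only [pairProb, Matrix.mul_apply, Matrix.transpose_apply, analysisOp, Matrix.of_apply,
    vectorize, realign, Fintype.sum_prod_type, hP, hQ, Finset.sum_mul]
  calc _ = ∑ y, ∑ x, ∑ y', ∑ x', P.elem α x' x * ρ (x, y) (x', y') * Q.elem β y' y :=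
        Finset.sum_congr rfl fun y _ => Finset.sum_comm
    _ = ∑ x, ∑ y, ∑ y', ∑ x', P.elem α x' x * ρ (x, y) (x', y') * Q.elem β y' y := Finset.sum_comm
    _ = _ := by
        refine Finset.sum_congr rfl fun x _ => Finset.sum_congr rfl fun y _ => ?_
        rw [Finset.sum_comm]
        refine Finset.sum_congr rfl fun x' _ => Finset.sum_congr rfl fun y' _ => ?_
        ring

theorem sum_comm_pairs {M κ μ ν ξ : Type} [AddCommMonoid M] [Fintype κ] [Fintype μ] [Fintype ν]
    [Fintype ξ] (T : κ → μ → ν → ξ → M) :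
    ∑ a, ∑ b, ∑ c, ∑ d, T a b c d = ∑ c, ∑ d, ∑ a, ∑ b, T a b c d := by
  rw [← Fintype.sum_prod_type' fun a b => ∑ c, ∑ d, T a b c d,
    ← Fintype.sum_prod_type' fun c d => ∑ a, ∑ b, T a b c d]
  simp only [← Fintype.sum_prod_type' fun c d => T _ _ c d]
  rw [Finset.sum_comm]
  refine Finset.sum_congr rfl fun p _ => ?_
  exact Fintype.sum_prod_type' fun a b => T a b p.1 p.2

/-- The transposition trick for the Choi state: applying `C` to `P_αᵀ / d` contracts the input index
of the Choi state with `P_α`, and identities on all other wires produce the marginal. -/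
theorem trace_tensorOp_mul_map (C : Channel (Joint dA) (Joint dB)) (i j : Fin n)
    (P : ICPOVM (dA i)) (Q : ICPOVM (dB j)) (α : Fin (dA i ^ 2)) (β : Fin (dB j ^ 2)) :
    (tensorOp (Function.update (fun _ => 1) j (Q.elem β)) *
      C.map ((Fintype.card (Joint dA) : ℂ)⁻¹ •
        tensorOp (Function.update (fun _ => 1) i (P.elem α)ᵀ))).trace =
      pairProb P Q (choiMarginal C i j) α β := by
  calc _ = ∑ g, ∑ g', tensorOp (Function.update (fun _ => 1) j (Q.elem β)ᵀ) g g' *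
        ∑ f, ∑ f', tensorOp (Function.update (fun _ => 1) i (P.elem α)ᵀ) f f' *
          choi C (f, g) (f', g') := by
        simp only [Matrix.trace, Matrix.diag_apply, Matrix.mul_apply]
        rw [Finset.sum_comm]
        refine Finset.sum_congr rfl fun g _ => Finset.sum_congr rfl fun g' _ => ?_
        rw [tensorOp_update_one_apply_swap, C.map_apply_eq_sum]
        congr 1
        refine Finset.sum_congr rfl fun f _ => Finset.sum_congr rfl fun f' _ => ?_
        simp only [Matrix.smul_apply, smul_eq_mul, choi, Matrix.of_apply]
        ring
    _ = ∑ f, ∑ g, ∑ x', ∑ y', (P.elem α)ᵀ (f i) x' * ((Q.elem β)ᵀ (g j) y' *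
          choi C (f, g) (Function.update f i x', Function.update g j y')) := by
        rw [Finset.sum_comm (γ := Joint dA)]
        refine Finset.sum_congr rfl fun g _ => ?_
        rw [sum_tensorOp_update_one_mul]
        simp only [sum_tensorOp_update_one_mul, Finset.mul_sum]
        rw [Finset.sum_comm]
        refine Finset.sum_congr rfl fun f _ => ?_
        rw [Finset.sum_comm]
        refine Finset.sum_congr rfl fun x' _ => Finset.sum_congr rfl fun y' _ => ?_
        ring
    _ = _ := by
        rw [pairProb_apply]
        have h : ∀ x y, ∑ x', ∑ y', (P.elem α)ᵀ x x' * ((Q.elem β)ᵀ y y' *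
            choiMarginal C i j (x, y) (x', y')) = ∑ f : Joint dA, ∑ g : Joint dB,
            if f i = x ∧ g j = y then ∑ x', ∑ y', (P.elem α)ᵀ (f i) x' * ((Q.elem β)ᵀ (g j) y' *
              choi C (f, g) (Function.update f i x', Function.update g j y')) else 0 := by
          intro x y
          simp only [choiMarginal, Matrix.of_apply, Finset.mul_sum]
          rw [sum_comm_pairs]
          refine Finset.sum_congr rfl fun f _ => Finset.sum_congr rfl fun g _ => ?_
          split_ifs with hfg
          · rw [hfg.1, hfg.2]
          · simp
        simp only [h]
        symm
        refine (sum_comm_pairs _).trans ?_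
        refine Finset.sum_congr rfl fun f _ => Finset.sum_congr rfl fun g _ => ?_
        rw [Finset.sum_eq_single (f i), Finset.sum_eq_single (g j)]
        · simp
        · intro y _ hy
          rw [if_neg fun hc => hy hc.2.symm]
        · simp
        · intro x _ hx
          exact Finset.sum_eq_zero fun y _ => if_neg fun hc => hx hc.1.symm
        · simp

theorem ofReal_trace_mul_re {ι : Type} [Fintype ι] {A B : Matrix ι ι ℂ}
    (hA : A.PosSemidef) (hB : B.PosSemidef) : (((A * B).trace.re : ℝ) : ℂ) = (A * B).trace := by
  obtain ⟨R, rfl⟩ := exists_conjTranspose_mul_self hA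
  rw [Matrix.mul_assoc, Matrix.trace_mul_comm]
  have h := Complex.le_def.mp (hB.mul_mul_conjTranspose_same R).trace_nonneg
  exact Complex.ext rfl (by simpa using h.2)

theorem bornWeight_nonneg {m : Fin n → ℕ} (C : Channel (Joint dA) (Joint dB))
    (ρ : ∀ i, DensityOp (dA i)) (M : ∀ j, POVM (dB j) (m j)) (b : Joint m) :
    0 ≤ bornWeight C ρ M b :=
  trace_mul_re_nonneg (tensorOp_posSemidef fun j => (M j).posSemidef _)
    (C.map_posSemidef (tensorOp_posSemidef fun i => (ρ i).posSemidef))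

/-- The probability of the inputs `s.1` and the outcomes `s.2` in one use of the channel. -/
noncomputable def sampleWeight (C : Channel (Joint dA) (Joint dB)) (P : ∀ i, ICPOVM (dA i))
    (Q : ∀ j, ICPOVM (dB j)) (s : (Joint fun i => dA i ^ 2) × (Joint fun j => dB j ^ 2)) : ℝ :=
  (∏ i, ((P i).elem (s.1 i)).trace.re / dA i) *
    bornWeight C (fun i => (P i).state (s.1 i)) (fun j => (Q j).toPOVM) s.2

theorem sampleWeight_nonneg (C : Channel (Joint dA) (Joint dB)) (P : ∀ i, ICPOVM (dA i))
    (Q : ∀ j, ICPOVM (dB j)) (s : (Joint fun i => dA i ^ 2) × (Joint fun j => dB j ^ 2)) :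
    0 ≤ sampleWeight C P Q s :=
  mul_nonneg (Finset.prod_nonneg fun i _ =>
    div_nonneg ((P i).toPOVM.trace_nonneg _).1 (Nat.cast_nonneg _)) (bornWeight_nonneg _ _ _ _)

theorem toReal_samples [∀ i, NeZero (dA i)] (C : Channel (Joint dA) (Joint dB))
    (P : ∀ i, ICPOVM (dA i)) (Q : ∀ j, ICPOVM (dB j))
    (N : ℕ) (a : Fin N → Joint fun i => dA i ^ 2) (b : Fin N → Joint fun j => dB j ^ 2) :
    (samples C P Q N (a, b)).toReal = ∏ k, sampleWeight C P Q (a k, b k) := by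
  rw [samples_apply, ENNReal.toReal_prod]
  refine Finset.prod_congr rfl fun k _ => ?_
  rw [ENNReal.toReal_mul, ENNReal.toReal_prod, sampleWeight]
  congr 1
  · refine Finset.prod_congr rfl fun i _ => ?_
    exact ENNReal.toReal_ofReal (div_nonneg ((P i).toPOVM.trace_nonneg _).1 (Nat.cast_nonneg _))
  · exact ENNReal.toReal_ofReal (bornWeight_nonneg _ _ _ _)

/-- The probability `Tr P_α / d` of an input cancels the normalisation of its state. What is left is
multilinear in the POVM elements, so sums over unobserved inputs and outcomes can be carried out
inside. -/
theorem ofReal_sampleWeight (C : Channel (Joint dA) (Joint dB)) (P : ∀ i, ICPOVM (dA i))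
    (Q : ∀ j, ICPOVM (dB j)) (a : Joint fun i => dA i ^ 2) (b : Joint fun j => dB j ^ 2) :
    (sampleWeight C P Q (a, b) : ℂ) = (tensorOp (fun j => (Q j).elem (b j)) *
      C.map ((Fintype.card (Joint dA) : ℂ)⁻¹ • tensorOp fun i => ((P i).elem (a i))ᵀ)).trace := by
  rw [sampleWeight, bornWeight, Complex.ofReal_mul, ofReal_trace_mul_re
    (tensorOp_posSemidef fun j => (Q j).posSemidef _)
    (C.map_posSemidef (tensorOp_posSemidef fun i => ((P i).state (a i)).posSemidef)),
    ← smul_eq_mul, ← Matrix.trace_smul, ← Matrix.mul_smul, ← map_smul]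
  have key : ((∏ i, ((P i).elem (a i)).trace.re / dA i : ℝ) : ℂ) •
      tensorOp (fun i => ((P i).state (a i)).mat) =
      (Fintype.card (Joint dA) : ℂ)⁻¹ • tensorOp fun i => ((P i).elem (a i))ᵀ := by
    ext f f'
    simp only [Matrix.smul_apply, tensorOp, Matrix.of_apply, ICPOVM.state, smul_eq_mul,
      Complex.ofReal_prod, Complex.ofReal_div, Complex.ofReal_natCast, Finset.prod_mul_distrib]
    have h1 : ∏ i, (((P i).elem (a i)).trace.re : ℂ) / (dA i : ℂ) =
        (Fintype.card (Joint dA) : ℂ)⁻¹ * ∏ i, ((P i).elem (a i)).trace := by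
      rw [Finset.prod_div_distrib, Fintype.card_pi]
      simp only [Fintype.card_fin, Nat.cast_prod, ((P _).toPOVM.trace_nonneg _).2]
      rw [div_eq_inv_mul]
    rw [h1, Finset.prod_inv_distrib]
    have h2 : ∏ i, ((P i).elem (a i)).trace ≠ 0 :=
      Finset.prod_ne_zero_iff.mpr fun i _ => (P i).trace_ne_zero _
    field_simp
  rw [key]

/-- The inputs of `A_i` and the outcomes of `B_j` are distributed as the outcomes of the POVM
`{P α ⊗ Q β}` on the marginal of the Choi state. -/
theorem sum_sampleWeight_eq_pairProb (C : Channel (Joint dA) (Joint dB)) (P : ∀ i, ICPOVM (dA i))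
    (Q : ∀ j, ICPOVM (dB j)) (i j : Fin n) (α : Fin (dA i ^ 2)) (β : Fin (dB j ^ 2)) :
    ((∑ s, sampleWeight C P Q s * if (s.1 i, s.2 j) = (α, β) then 1 else 0 : ℝ) : ℂ) =
      pairProb (P i) (Q j) (choiMarginal C i j) α β := by
  rw [← trace_tensorOp_mul_map]
  have h1 : tensorOp (Function.update (fun _ => 1) j ((Q j).elem β)) =
      ∑ b : Joint fun j => dB j ^ 2,
        if b j = β then tensorOp (fun j => (Q j).elem (b j)) else 0 := by
    rw [sum_ite_tensorOp (fun j => (Q j).elem) j β]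
    simp only [POVM.sum_eq_one]
  have h2 : tensorOp (Function.update (fun _ => 1) i ((P i).elem α)ᵀ) =
      ∑ a : Joint fun i => dA i ^ 2,
        if a i = α then tensorOp (fun i => ((P i).elem (a i))ᵀ) else 0 := by
    rw [sum_ite_tensorOp (fun i x => ((P i).elem x)ᵀ) i α]
    simp only [← Matrix.transpose_sum, POVM.sum_eq_one, Matrix.transpose_one]
  rw [h1, h2, Finset.smul_sum, map_sum, Finset.mul_sum, Matrix.trace_sum, Fintype.sum_prod_type,
    Complex.ofReal_sum]
  refine Finset.sum_congr rfl fun a _ => ?_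
  rw [Finset.sum_mul, Matrix.trace_sum, Complex.ofReal_sum]
  refine Finset.sum_congr rfl fun b _ => ?_
  by_cases ha : a i = α <;> by_cases hb : b j = β <;> simp [ha, hb, ofReal_sampleWeight]

theorem sum_sampleWeight [∀ i, NeZero (dA i)] (C : Channel (Joint dA) (Joint dB))
    (P : ∀ i, ICPOVM (dA i)) (Q : ∀ j, ICPOVM (dB j)) : ∑ s, sampleWeight C P Q s = 1 := by
  apply Complex.ofReal_injective
  have hA : ∑ a : Joint fun i => dA i ^ 2, tensorOp (fun i => ((P i).elem (a i))ᵀ) = 1 := by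
    rw [sum_tensorOp fun i x => ((P i).elem x)ᵀ]
    simp only [← Matrix.transpose_sum, POVM.sum_eq_one, Matrix.transpose_one, tensorOp_one]
  have hB : ∑ b : Joint fun j => dB j ^ 2, tensorOp (fun j => (Q j).elem (b j)) = 1 := by
    rw [sum_tensorOp fun j => (Q j).elem]
    simp only [POVM.sum_eq_one, tensorOp_one]
  rw [Complex.ofReal_sum, Fintype.sum_prod_type]
  simp only [ofReal_sampleWeight]
  simp only [← Matrix.trace_sum, ← Finset.sum_mul, hB, Matrix.one_mul, C.trace_map,
    Matrix.trace_smul, smul_eq_mul]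
  rw [← Finset.mul_sum, ← Matrix.trace_sum, hA, Matrix.trace_one, Complex.ofReal_one,
    inv_mul_cancel₀]
  exact Nat.cast_ne_zero.mpr Fintype.card_ne_zero

end Sampling

/-! ### Concentration of the empirical frequencies -/

section Concentration

variable {Ω : Type} [Fintype Ω] {w X : Ω → ℝ}

/-- From `exp y ≤ 1 + y + y²` for `|y| ≤ 1`: the linear term averages to zero, and `1 + s² ≤ exp
(s²)`. -/
theorem sum_mul_exp_le (hw : ∀ x, 0 ≤ w x) (hw1 : ∑ x, w x = 1) (hX : ∀ x, X x ∈ Set.Icc 0 1)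
    {s : ℝ} (hs : |s| ≤ 1) :
    ∑ x, w x * Real.exp (s * (X x - ∑ y, w y * X y)) ≤ Real.exp (s ^ 2) := by
  set p := ∑ y, w y * X y with hp
  have hp0 : 0 ≤ p := Finset.sum_nonneg fun x _ => mul_nonneg (hw x) (hX x).1
  have hp1 : p ≤ 1 := by
    rw [← hw1]
    exact Finset.sum_le_sum fun x _ => mul_le_of_le_one_right (hw x) (hX x).2
  have h1 : ∀ x, Real.exp (s * (X x - p)) ≤ 1 + s * (X x - p) + s ^ 2 := by
    intro x
    have hd : |X x - p| ≤ 1 := abs_le.mpr ⟨by linarith [(hX x).1], by linarith [(hX x).2]⟩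
    have hy : |s * (X x - p)| ≤ 1 := by
      rw [abs_mul]
      exact mul_le_one₀ hs (abs_nonneg _) hd
    have h2 := (abs_le.mp (Real.abs_exp_sub_one_sub_id_le hy)).2
    have h3 : (s * (X x - p)) ^ 2 ≤ s ^ 2 := by
      rw [mul_pow]
      exact mul_le_of_le_one_right (sq_nonneg s) ((sq_le_one_iff_abs_le_one _).mpr hd)
    linarith
  calc _ ≤ ∑ x, w x * (1 + s * (X x - p) + s ^ 2) :=
        Finset.sum_le_sum fun x _ => mul_le_mul_of_nonneg_left (h1 x) (hw x)
    _ = ∑ x, (w x * (1 - s * p + s ^ 2) + s * (w x * X x)) :=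
        Finset.sum_congr rfl fun x _ => by ring
    _ = 1 + s ^ 2 := by
        rw [Finset.sum_add_distrib, ← Finset.sum_mul, ← Finset.mul_sum, hw1, ← hp]
        ring
    _ ≤ _ := by linarith [Real.add_one_le_exp (s ^ 2)]

theorem sum_prod_mul_exp_le (hw : ∀ x, 0 ≤ w x) (hw1 : ∑ x, w x = 1)
    (hX : ∀ x, X x ∈ Set.Icc 0 1) {s : ℝ} (hs : |s| ≤ 1) (N : ℕ) :
    ∑ ω : Fin N → Ω, (∏ k, w (ω k)) * Real.exp (s * ∑ k, (X (ω k) - ∑ y, w y * X y)) ≤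
      Real.exp (N * s ^ 2) := by
  rw [mul_comm, mul_comm (s ^ 2), Real.exp_nat_mul]
  refine le_trans (le_of_eq ?_) (pow_le_pow_left₀
    (Finset.sum_nonneg fun x _ => mul_nonneg (hw x) (Real.exp_nonneg _))
    (sum_mul_exp_le hw hw1 hX hs) N)
  rw [Fintype.sum_pow]
  refine Finset.sum_congr rfl fun ω _ => ?_
  rw [Finset.prod_mul_distrib, ← Real.exp_sum, Finset.mul_sum]

/-- A Hoeffding inequality for the mean of `N` independent samples from the weights `w`. -/
theorem sum_prod_deviation_le (hw : ∀ x, 0 ≤ w x) (hw1 : ∑ x, w x = 1)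
    (hX : ∀ x, X x ∈ Set.Icc 0 1) {t : ℝ} (ht : 0 < t) (ht1 : t ≤ 1) {N : ℕ} (hN : 0 < N) :
    ∑ ω : Fin N → Ω, (∏ k, w (ω k)) *
      (if t < |(∑ k, X (ω k)) / N - ∑ y, w y * X y| then 1 else 0) ≤
      2 * Real.exp (-(N * t ^ 2 / 4)) := by
  set p := ∑ y, w y * X y with hp
  have hN' : (0 : ℝ) < N := Nat.cast_pos.mpr hN
  -- Exponential Markov inequality for both tails. The parameter `s = t / 2` minimises `-s N t + N
  -- s²`, the exponent left after the moment bound, and gives `-N t² / 4`.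
  have h1 : ∀ ω : Fin N → Ω, (if t < |(∑ k, X (ω k)) / N - p| then (1 : ℝ) else 0) ≤
      Real.exp (-(N * t ^ 2 / 2)) * (Real.exp (t / 2 * ∑ k, (X (ω k) - p)) +
        Real.exp (-(t / 2) * ∑ k, (X (ω k) - p))) := by
    intro ω
    have h2 : (∑ k, X (ω k)) / N - p = (∑ k, (X (ω k) - p)) / N := by
      rw [Finset.sum_sub_distrib]
      simp only [Finset.sum_const, Finset.card_univ, Fintype.card_fin, nsmul_eq_mul]
      field_simp
    rw [h2]
    generalize ∑ k, (X (ω k) - p) = Y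
    split_ifs with h
    · rw [abs_div, Nat.abs_cast, lt_div_iff₀ hN'] at h
      rw [mul_add, ← Real.exp_add, ← Real.exp_add]
      rcases lt_abs.mp h with h | h
      · refine le_add_of_le_of_nonneg (Real.one_le_exp ?_) (Real.exp_nonneg _)
        nlinarith
      · refine le_add_of_nonneg_of_le (Real.exp_nonneg _) (Real.one_le_exp ?_)
        nlinarith
    · positivity
  have h3 := sum_prod_mul_exp_le hw hw1 hX (s := t / 2) (by rw [abs_of_pos] <;> linarith) N
  have h4 := sum_prod_mul_exp_le hw hw1 hX (s := -(t / 2))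
    (by rw [abs_neg, abs_of_pos] <;> linarith) N
  calc _ ≤ ∑ ω : Fin N → Ω, (∏ k, w (ω k)) * (Real.exp (-(N * t ^ 2 / 2)) *
          (Real.exp (t / 2 * ∑ k, (X (ω k) - p)) + Real.exp (-(t / 2) * ∑ k, (X (ω k) - p)))) :=
        Finset.sum_le_sum fun ω _ =>
          mul_le_mul_of_nonneg_left (h1 ω) (Finset.prod_nonneg fun k _ => hw _)
    _ = Real.exp (-(N * t ^ 2 / 2)) *
          (∑ ω : Fin N → Ω, (∏ k, w (ω k)) * Real.exp (t / 2 * ∑ k, (X (ω k) - p)) +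
          ∑ ω : Fin N → Ω, (∏ k, w (ω k)) * Real.exp (-(t / 2) * ∑ k, (X (ω k) - p))) := by
        rw [← Finset.sum_add_distrib, Finset.mul_sum]
        refine Finset.sum_congr rfl fun ω _ => ?_
        ring
    _ ≤ Real.exp (-(N * t ^ 2 / 2)) *
          (Real.exp (N * (t / 2) ^ 2) + Real.exp (N * (-(t / 2)) ^ 2)) := by gcongr
    _ = _ := by
        rw [neg_sq, ← two_mul, mul_left_comm, ← Real.exp_add]
        congr 2
        ring

end Concentration

/-! ### Accurate frequencies give correct decisions -/

section Accuracy

open scoped Matrix.Norms.Frobenius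

/-- One-dimensional wires are uncorrelated. This excludes the case `d_A d_B = 1`, in which the
logarithm in the query bound could be arbitrarily small. -/
theorem chiOne_eq_zero_of_subsingleton {α β : Type} [Fintype α] [Fintype β] [DecidableEq α]
    [DecidableEq β] [Subsingleton α] [Subsingleton β] {ρ : Matrix (α × β) (α × β) ℂ}
    (ht : ρ.trace = 1) : chiOne ρ ≤ 0 := by
  have h0 : ρ - traceRight ρ ⊗ₖ traceLeft ρ = 0 := by
    ext p q
    obtain rfl := Subsingleton.elim p q
    have : Unique α := ⟨⟨p.1⟩, fun _ => Subsingleton.elim _ _⟩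
    have : Unique β := ⟨⟨p.2⟩, fun _ => Subsingleton.elim _ _⟩
    have h1 : ρ p p = 1 := by
      rw [← ht, Matrix.trace, Fintype.sum_subsingleton _ p, Matrix.diag_apply]
    have h2 : traceRight ρ p.1 p.1 = 1 := by
      rw [traceRight, Matrix.of_apply, Fintype.sum_subsingleton _ p.2]
      exact h1
    have h3 : traceLeft ρ p.2 p.2 = 1 := by
      rw [traceLeft, Matrix.of_apply, Fintype.sum_subsingleton _ p.1]
      exact h1
    rw [Matrix.sub_apply, Matrix.kroneckerMap_apply, h1, h2, h3]
    simp
  have := traceNorm_le_frobenius (ρ - traceRight ρ ⊗ₖ traceLeft ρ)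
  rw [chiOne]
  refine this.trans ?_
  rw [h0, norm_zero, mul_zero]

/-- The error budget: `a b` times the entrywise error bounds the Frobenius error of the frequencies,
inversion multiplies it by `lam⁻¹`, giving at most `χ / (16 D)`, and the Lipschitz constant `4 D`
turns this into `χ / 4`. The assumption `χ ≤ 2 D` keeps the perturbation below 1, as the Lipschitz
bound requires. -/
theorem abs_chiOne_reconstructed_sub_lt {a b : ℕ} [NeZero a] [NeZero b] (P : ICPOVM a)
    (Q : ICPOVM b) {ρ : Matrix (Fin a × Fin b) (Fin a × Fin b) ℂ} (hρ : ρ.PosSemidef)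
    (htr : ρ.trace = 1) (p : Matrix (Fin (a ^ 2)) (Fin (b ^ 2)) ℂ) {lam χ D : ℝ} (h0 : 0 < lam)
    (hP : lam ≤ frameLambdaMin P.toPOVM) (hQ : lam ≤ frameLambdaMin Q.toPOVM) (hχ : 0 < χ)
    (hD : (a : ℝ) * b ≤ D) (hχD : χ ≤ 2 * D)
    (hp : ∀ α β, ‖p α β - pairProb P Q ρ α β‖ ≤ lam * χ / (16 * D ^ 2)) :
    |chiOne (reconstructed P Q p) - chiOne ρ| < χ / 2 := by
  have ha : (0 : ℝ) < a := Nat.cast_pos.mpr (NeZero.pos a)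
  have hb : (0 : ℝ) < b := Nat.cast_pos.mpr (NeZero.pos b)
  have hab : 0 < (a : ℝ) * b := mul_pos ha hb
  have hD0 : 0 < D := hab.trans_le hD
  have h1 : ‖reconstructed P Q p - ρ‖ ≤ χ / (16 * D) := by
    refine (norm_reconstructed_sub_le P Q p ρ h0 hP hQ).trans ?_
    have h2 := norm_le_mul_of_entry_le (p - pairProb P Q ρ) (by positivity) hp
    calc _ ≤ lam⁻¹ * (D * (lam * χ / (16 * D ^ 2))) := by
          gcongr
          exact h2.trans (by gcongr)
      _ = _ := by field_simp
  have h3 : χ / (16 * D) ≤ 1 := by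
    rw [div_le_one (by positivity)]
    linarith
  have h4 := abs_chiOne_sub_le hρ htr h1 h3
  rw [Fintype.card_fin, Fintype.card_fin] at h4
  calc _ ≤ 4 * (a * b) * (χ / (16 * D)) := h4
    _ ≤ 4 * D * (χ / (16 * D)) := by gcongr
    _ = χ / 4 := by field_simp; norm_num
    _ < _ := by linarith

theorem empirical_sub_pairProb {n : ℕ} {dA dB : Fin n → ℕ} (C : Channel (Joint dA) (Joint dB))
    (P : ∀ i, ICPOVM (dA i)) (Q : ∀ j, ICPOVM (dB j)) (i j : Fin n) (α : Fin (dA i ^ 2))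
    (β : Fin (dB j ^ 2)) {N : ℕ}
    (ω : Fin N → (Joint fun i => dA i ^ 2) × (Joint fun j => dB j ^ 2)) :
    ‖empirical (fun k => ((ω k).1 i, (ω k).2 j)) α β -
        pairProb (P i) (Q j) (choiMarginal C i j) α β‖ =
      |(∑ k, if ((ω k).1 i, (ω k).2 j) = (α, β) then (1 : ℝ) else 0) / N -
        ∑ s, sampleWeight C P Q s * if (s.1 i, s.2 j) = (α, β) then 1 else 0| := by
  have h1 : empirical (fun k => ((ω k).1 i, (ω k).2 j)) α β =
      (((∑ k, if ((ω k).1 i, (ω k).2 j) = (α, β) then (1 : ℝ) else 0) / N : ℝ) : ℂ) := by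
    rw [empirical, Complex.ofReal_div, Complex.ofReal_sum, Finset.sum_div]
    refine Finset.sum_congr rfl fun k _ => ?_
    split_ifs <;> simp
  rw [h1, ← sum_sampleWeight_eq_pairProb, ← Complex.ofReal_sub, Complex.norm_real, Real.norm_eq_abs]

variable {n : ℕ} {dA dB : Fin n → ℕ} [∀ i, NeZero (dA i)] [∀ j, NeZero (dB j)]
  (P : ∀ i, ICPOVM (dA i)) (Q : ∀ j, ICPOVM (dB j))

omit [∀ i, NeZero (dA i)] [∀ j, NeZero (dB j)] in
theorem lambdaMin_le_left (i : Fin n) : lambdaMin P Q ≤ frameLambdaMin (P i).toPOVM :=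
  (min_le_left _ _).trans (ciInf_le (Set.finite_range _).bddBelow i)

omit [∀ i, NeZero (dA i)] [∀ j, NeZero (dB j)] in
theorem lambdaMin_le_right (j : Fin n) : lambdaMin P Q ≤ frameLambdaMin (Q j).toPOVM :=
  (min_le_right _ _).trans (ciInf_le (Set.finite_range _).bddBelow j)

theorem lambdaMin_pos (hn : 0 < n) : 0 < lambdaMin P Q := by
  have : Nonempty (Fin n) := ⟨⟨0, hn⟩⟩
  obtain ⟨i, hi⟩ := exists_eq_ciInf_of_finite (f := fun i => frameLambdaMin (P i).toPOVM)
  obtain ⟨j, hj⟩ := exists_eq_ciInf_of_finite (f := fun j => frameLambdaMin (Q j).toPOVM)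
  rw [lambdaMin, ← hi, ← hj]
  exact lt_min (frameLambdaMin_pos _) (frameLambdaMin_pos _)

theorem le_maxDim (d : Fin n → ℕ) (i : Fin n) : d i ≤ maxDim d :=
  Finset.le_sup (f := d) (Finset.mem_univ i)

theorem exists_eq_maxDim (hn : 0 < n) (d : Fin n → ℕ) : ∃ i, d i = maxDim d := by
  have : Nonempty (Fin n) := ⟨⟨0, hn⟩⟩
  obtain ⟨i, -, hi⟩ := Finset.exists_mem_eq_sup Finset.univ Finset.univ_nonempty d
  exact ⟨i, hi.symm⟩

/-- The product of `λ_min d_A ≤ 1` and `λ_min d_B ≤ 1`. It turns `λ_min⁻²` into a lower bound for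
the number of queries in terms of the dimensions. -/
theorem lambdaMin_sq_mul_le_one (hn : 0 < n) :
    lambdaMin P Q ^ 2 * (maxDim dA * maxDim dB) ≤ 1 := by
  obtain ⟨i, hi⟩ := exists_eq_maxDim hn dA
  obtain ⟨j, hj⟩ := exists_eq_maxDim hn dB
  have h0 := (lambdaMin_pos P Q hn).le
  have h1 : lambdaMin P Q * maxDim dA ≤ 1 := by
    rw [← hi]
    exact le_trans (by gcongr; exact lambdaMin_le_left P Q i)
      (frameLambdaMin_mul_dim_le_one (P i).toPOVM)
  have h2 : lambdaMin P Q * maxDim dB ≤ 1 := by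
    rw [← hj]
    exact le_trans (by gcongr; exact lambdaMin_le_right P Q j)
      (frameLambdaMin_mul_dim_le_one (Q j).toPOVM)
  calc _ = (lambdaMin P Q * maxDim dA) * (lambdaMin P Q * maxDim dB) := by ring
    _ ≤ 1 := mul_le_one₀ h1 (by positivity) h2

variable {P Q} {C : Channel (Joint dA) (Joint dB)} {σ π : Equiv.Perm (Fin n)} {χmin : ℝ}

theorem TotallyCorrelated.le_sqrt (hn : 0 < n) (h : TotallyCorrelated C σ π χmin) :
    χmin ≤ 2 * √(maxDim dA * maxDim dB) := by
  let k : Fin n := ⟨0, hn⟩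
  refine ((h k k).2 le_rfl).trans ((chiOne_le (choiMarginal_posSemidef C _ _)
    (choiMarginal_trace C _ _)).trans ?_)
  rw [Fintype.card_fin, Fintype.card_fin]
  have := le_maxDim dA (σ k)
  have := le_maxDim dB (π k)
  gcongr

theorem TotallyCorrelated.two_le (hn : 0 < n) (hχ : 0 < χmin) (h : TotallyCorrelated C σ π χmin) :
    2 ≤ maxDim dA * maxDim dB := by
  let k : Fin n := ⟨0, hn⟩
  have h1 : dA (σ k) ≤ maxDim dA := le_maxDim dA (σ k)
  have h2 : dB (π k) ≤ maxDim dB := le_maxDim dB (π k)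
  have hA := NeZero.pos (dA (σ k))
  have hB := NeZero.pos (dB (π k))
  by_contra hc
  have hA1 : dA (σ k) ≤ 1 := by nlinarith
  have hB1 : dB (π k) ≤ 1 := by nlinarith
  have : Subsingleton (Fin (dA (σ k))) := Fin.subsingleton_iff_le_one.mpr hA1
  have : Subsingleton (Fin (dB (π k))) := Fin.subsingleton_iff_le_one.mpr hB1
  have h3 := (h k k).2 le_rfl
  have h4 := chiOne_eq_zero_of_subsingleton (choiMarginal_trace C (σ k) (π k))
  linarith

theorem TotallyCorrelated.le_two_mul (hn : 0 < n) (hχ : 0 < χmin)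
    (h : TotallyCorrelated C σ π χmin) : χmin ≤ 2 * (maxDim dA * maxDim dB) := by
  have hD : (2 : ℝ) ≤ maxDim dA * maxDim dB := by exact_mod_cast h.two_le hn hχ
  refine (h.le_sqrt hn).trans ?_
  gcongr
  exact Real.sqrt_le_iff.mpr ⟨by linarith, by nlinarith⟩

/-- If all the frequencies are accurate, the algorithm returns the causal order. -/
theorem causalOrderOf_decisions_eq (hn : 0 < n) (hχ : 0 < χmin)
    (h : TotallyCorrelated C σ π χmin) {N : ℕ}
    (ω : Fin N → (Joint fun i => dA i ^ 2) × (Joint fun j => dB j ^ 2))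
    (hω : ∀ i j α β, |(∑ k, if ((ω k).1 i, (ω k).2 j) = (α, β) then (1 : ℝ) else 0) / N -
        ∑ s, sampleWeight C P Q s * if (s.1 i, s.2 j) = (α, β) then 1 else 0| ≤
      lambdaMin P Q * χmin / (16 * (maxDim dA * maxDim dB) ^ 2)) :
    causalOrderOf (decisions P Q (χmin / 2) (fun k => (ω k).1) fun k => (ω k).2) =
      List.ofFn fun k => (σ k, π k) := by
  have hD : (2 : ℝ) ≤ maxDim dA * maxDim dB := by exact_mod_cast h.two_le hn hχ
  have hχD := h.le_two_mul hn hχ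
  refine causalOrderOf_eq _ σ π fun i j => ?_
  have h1 := abs_chiOne_reconstructed_sub_lt (P (σ i)) (Q (π j))
    (choiMarginal_posSemidef C (σ i) (π j)) (choiMarginal_trace C (σ i) (π j))
    (empirical fun k => ((ω k).1 (σ i), (ω k).2 (π j))) (lambdaMin_pos P Q hn)
    (lambdaMin_le_left P Q _) (lambdaMin_le_right P Q _) hχ (D := maxDim dA * maxDim dB)
    (by
      have := le_maxDim dA (σ i)
      have := le_maxDim dB (π j)
      gcongr) hχD
    fun α β => (empirical_sub_pairProb C P Q (σ i) (π j) α β ω).trans_le (hω _ _ α β)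
  rw [abs_lt] at h1
  simp only [decisions, Instr.eval]
  -- The error is strictly below `χmin / 2`, so an estimate stays below the threshold if the true
  -- value is 0 and above it if the true value is at least `χmin`.
  rw [decide_eq_decide]
  constructor
  · intro h2
    by_contra hc
    have := (h i j).2 (not_lt.mp hc)
    linarith
  · intro h2
    have := (h i j).1 h2
    linarith

end Accuracy

/-! ### The theorem -/

section Main

variable {n : ℕ} {dA dB : Fin n → ℕ} [∀ i, NeZero (dA i)] [∀ j, NeZero (dB j)]
  {P : ∀ i, ICPOVM (dA i)} {Q : ∀ j, ICPOVM (dB j)}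
  {C : Channel (Joint dA) (Joint dB)} {σ π : Equiv.Perm (Fin n)} {χmin κ : ℝ}

/-- The algorithm fails with probability at most `2 n² d_A² d_B² exp (-N t² / 4)`, where `t` is the
accuracy of the frequencies that it needs. -/
theorem one_sub_le_discoverOrder (hn : 0 < n) (hχ : 0 < χmin) (h : TotallyCorrelated C σ π χmin)
    {N : ℕ} (hN : 0 < N) :
    1 - n ^ 2 * (maxDim dA * maxDim dB) ^ 2 * (2 * Real.exp (-(N *
      (lambdaMin P Q * χmin / (16 * (maxDim dA * maxDim dB) ^ 2)) ^ 2 / 4))) ≤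
    (((discoverOrder P Q N χmin).run C).toOuterMeasure
      {r | r.value = List.ofFn fun k => (σ k, π k)}).toReal := by
  classical
  set t := lambdaMin P Q * χmin / (16 * (maxDim dA * maxDim dB) ^ 2 : ℝ) with ht
  have hD : (2 : ℝ) ≤ maxDim dA * maxDim dB := by exact_mod_cast h.two_le hn hχ
  have hlam := lambdaMin_pos P Q hn
  have ht0 : 0 < t := by positivity
  -- The tail bound is valid only for deviations up to 1.
  have ht1 : t ≤ 1 := by
    have h1 := lambdaMin_sq_mul_le_one P Q hn
    have h2 : lambdaMin P Q ≤ 1 := by nlinarith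
    have h3 := h.le_two_mul hn hχ
    rw [ht, div_le_one (by positivity)]
    nlinarith
  set good : Set (Fin N → (Joint fun i => dA i ^ 2) × (Joint fun j => dB j ^ 2)) :=
    {ω | causalOrderOf (decisions P Q (χmin / 2) (fun k => (ω k).1) fun k => (ω k).2) =
      List.ofFn fun k => (σ k, π k)} with hgood
  have e1 : (((discoverOrder P Q N χmin).run C).toOuterMeasure
      {r | r.value = List.ofFn fun k => (σ k, π k)}).toReal =
      ∑ ω : Fin N → (Joint fun i => dA i ^ 2) × (Joint fun j => dB j ^ 2),
        (∏ k, sampleWeight C P Q (ω k)) * if ω ∈ good then 1 else 0 := by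
    have : ((discoverOrder P Q N χmin).run C).toOuterMeasure
        {r | r.value = List.ofFn fun k => (σ k, π k)} =
        ((discoverOrder P Q N χmin).law C).toOuterMeasure {List.ofFn fun k => (σ k, π k)} := by
      rw [Prog.law, PMF.toOuterMeasure_map_apply]
      rfl
    rw [this, law_discoverOrder, PMF.toOuterMeasure_map_apply, PMF.toOuterMeasure_apply_fintype,
      ENNReal.toReal_sum]
    -- The program returns a pair of arrays, while the tail bound concerns an array of pairs.
    · refine Fintype.sum_equiv (Equiv.arrowProdEquivProdArrow _ _ _).symm _ _ fun s => ?_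
      rw [Set.indicator_apply]
      have : s ∈ ((fun s => causalOrderOf (decisions P Q (χmin / 2) s.1 s.2)) ⁻¹'
          {List.ofFn fun k => (σ k, π k)}) ↔
          (Equiv.arrowProdEquivProdArrow _ _ _).symm s ∈ good := Iff.rfl
      by_cases hs : (Equiv.arrowProdEquivProdArrow _ _ _).symm s ∈ good
      · rw [if_pos (this.mpr hs), if_pos hs, mul_one]
        exact toReal_samples C P Q N s.1 s.2
      · rw [if_neg (this.not.mpr hs), if_neg hs, mul_zero, ENNReal.toReal_zero]
    · intro s _
      rw [Set.indicator_apply]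
      split_ifs
      · exact PMF.apply_ne_top _ _
      · simp
  have hw := sampleWeight_nonneg C P Q
  have hw1 := sum_sampleWeight C P Q
  let Y : ∀ i j : Fin n, Fin (dA i ^ 2) → Fin (dB j ^ 2) →
      (Joint fun i => dA i ^ 2) × (Joint fun j => dB j ^ 2) → ℝ :=
    fun i j α β s => if (s.1 i, s.2 j) = (α, β) then 1 else 0
  have e2 : ∑ ω : Fin N → (Joint fun i => dA i ^ 2) × (Joint fun j => dB j ^ 2),
      ∏ k, sampleWeight C P Q (ω k) = 1 := by
    rw [← Fintype.sum_pow, hw1, one_pow]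
  -- The union bound, pointwise in indicators: a run is good, or some frequency deviates by more
  -- than `t`.
  have e3 : ∀ ω : Fin N → (Joint fun i => dA i ^ 2) × (Joint fun j => dB j ^ 2),
      1 ≤ (if ω ∈ good then (1 : ℝ) else 0) + ∑ i, ∑ j, ∑ α, ∑ β,
        if t < |(∑ k, Y i j α β (ω k)) / N - ∑ s, sampleWeight C P Q s * Y i j α β s|
        then 1 else 0 := by
    intro ω
    have hnn : ∀ i j α β, (0 : ℝ) ≤ if t < |(∑ k, Y i j α β (ω k)) / N -
        ∑ s, sampleWeight C P Q s * Y i j α β s| then 1 else 0 := by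
      intro i j α β
      split_ifs <;> norm_num
    by_cases hω : ∀ i j α β, |(∑ k, Y i j α β (ω k)) / N -
        ∑ s, sampleWeight C P Q s * Y i j α β s| ≤ t
    · have hg : ω ∈ good := causalOrderOf_decisions_eq hn hχ h ω hω
      rw [if_pos hg]
      exact le_add_of_nonneg_right (Finset.sum_nonneg fun i _ => Finset.sum_nonneg fun j _ =>
        Finset.sum_nonneg fun α _ => Finset.sum_nonneg fun β _ => hnn i j α β)
    · push Not at hω
      obtain ⟨i, j, α, β, hlt⟩ := hω
      refine le_add_of_nonneg_of_le (by split_ifs <;> norm_num) ?_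
      calc (1 : ℝ) = if t < |(∑ k, Y i j α β (ω k)) / N -
            ∑ s, sampleWeight C P Q s * Y i j α β s| then 1 else 0 := (if_pos hlt).symm
        _ ≤ ∑ β, if t < |(∑ k, Y i j α β (ω k)) / N -
            ∑ s, sampleWeight C P Q s * Y i j α β s| then 1 else 0 :=
          Finset.single_le_sum (f := fun β => if t < |(∑ k, Y i j α β (ω k)) / N -
            ∑ s, sampleWeight C P Q s * Y i j α β s| then (1 : ℝ) else 0)
            (fun β _ => hnn i j α β) (Finset.mem_univ β)
        _ ≤ ∑ α, ∑ β, if t < |(∑ k, Y i j α β (ω k)) / N -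
            ∑ s, sampleWeight C P Q s * Y i j α β s| then 1 else 0 :=
          Finset.single_le_sum (f := fun α => ∑ β, if t < |(∑ k, Y i j α β (ω k)) / N -
            ∑ s, sampleWeight C P Q s * Y i j α β s| then (1 : ℝ) else 0)
            (fun α _ => Finset.sum_nonneg fun β _ => hnn i j α β) (Finset.mem_univ α)
        _ ≤ ∑ j, ∑ α, ∑ β, if t < |(∑ k, Y i j α β (ω k)) / N -
            ∑ s, sampleWeight C P Q s * Y i j α β s| then 1 else 0 :=
          Finset.single_le_sum (f := fun j => ∑ α, ∑ β, if t < |(∑ k, Y i j α β (ω k)) / N -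
            ∑ s, sampleWeight C P Q s * Y i j α β s| then (1 : ℝ) else 0)
            (fun j _ => Finset.sum_nonneg fun α _ => Finset.sum_nonneg fun β _ => hnn i j α β)
            (Finset.mem_univ j)
        _ ≤ _ :=
          Finset.single_le_sum (f := fun i => ∑ j, ∑ α, ∑ β, if t < |(∑ k, Y i j α β (ω k)) / N -
            ∑ s, sampleWeight C P Q s * Y i j α β s| then (1 : ℝ) else 0)
            (fun i _ => Finset.sum_nonneg fun j _ => Finset.sum_nonneg fun α _ =>
              Finset.sum_nonneg fun β _ => hnn i j α β) (Finset.mem_univ i)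
  rw [e1, sub_le_iff_le_add]
  calc (1 : ℝ) = ∑ ω : Fin N → (Joint fun i => dA i ^ 2) × (Joint fun j => dB j ^ 2),
        (∏ k, sampleWeight C P Q (ω k)) * 1 := by simp only [mul_one, e2]
    _ ≤ ∑ ω : Fin N → (Joint fun i => dA i ^ 2) × (Joint fun j => dB j ^ 2),
        (∏ k, sampleWeight C P Q (ω k)) * ((if ω ∈ good then (1 : ℝ) else 0) +
        ∑ i, ∑ j, ∑ α, ∑ β, if t < |(∑ k, Y i j α β (ω k)) / N -
          ∑ s, sampleWeight C P Q s * Y i j α β s| then 1 else 0) :=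
        Finset.sum_le_sum fun ω _ => mul_le_mul_of_nonneg_left (e3 ω)
          (Finset.prod_nonneg fun k _ => hw _)
    _ ≤ _ := by
        simp only [mul_add, Finset.sum_add_distrib]
        gcongr
        simp only [Finset.mul_sum]
        rw [Finset.sum_comm]
        calc _ ≤ ∑ i : Fin n, ∑ j : Fin n, ∑ _α : Fin (dA i ^ 2), ∑ _β : Fin (dB j ^ 2),
              2 * Real.exp (-(N * t ^ 2 / 4)) := by
              refine Finset.sum_le_sum fun i _ => ?_
              rw [Finset.sum_comm]
              refine Finset.sum_le_sum fun j _ => ?_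
              rw [Finset.sum_comm]
              refine Finset.sum_le_sum fun α _ => ?_
              rw [Finset.sum_comm]
              refine Finset.sum_le_sum fun β _ => ?_
              refine sum_prod_deviation_le hw hw1 (fun s => ?_) ht0 ht1 hN
              simp only [Y]
              split_ifs <;> norm_num
          _ ≤ ∑ _i : Fin n, ∑ _j : Fin n, (maxDim dA ^ 2 : ℝ) * (maxDim dB ^ 2 *
              (2 * Real.exp (-(N * t ^ 2 / 4)))) := by
              gcongr with i _ j _
              simp only [Finset.sum_const, Finset.card_univ, Fintype.card_fin, nsmul_eq_mul,
                Nat.cast_pow]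
              have := le_maxDim dA i
              have := le_maxDim dB j
              gcongr
          _ = _ := by
              simp only [Finset.sum_const, Finset.card_univ, Fintype.card_fin, nsmul_eq_mul]
              ring

end Main

end CausalOrder

/-! ### The size of the query bound and the choice of constants -/

/-- With `D = d_A d_B`, the bounds `λ_min⁻² ≥ D` and `χ_min⁻² ≥ 1 / (4 D)` compensate each other,
and `D ≥ 2` makes the logarithm at least `1 / 2`. So `N ≥ 4096 X` pays for the `O(D⁴)` tomography of
a pair, and `X ≥ 2` since `D⁴ ≥ 16`. -/
theorem CausalOrder.TotallyCorrelated.le_queryBound {n : ℕ} {dA dB : Fin n → ℕ}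
    [∀ i, NeZero (dA i)] [∀ j, NeZero (dB j)] {P : ∀ i, ICPOVM (dA i)} {Q : ∀ j, ICPOVM (dB j)}
    {C : Channel (Joint dA) (Joint dB)} {σ π : Equiv.Perm (Fin n)} {χmin κ : ℝ}
    (hn : 0 < n) (hχ : 0 < χmin) (hκ : 0 < κ) (hκ1 : κ < 1) (h : TotallyCorrelated C σ π χmin) :
    ((maxDim dA : ℝ) * maxDim dB) ^ 4 / 8 ≤ queryBound P Q χmin κ := by
  have hD : (2 : ℝ) ≤ maxDim dA * maxDim dB := by exact_mod_cast h.two_le hn hχ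
  have hn1 : (1 : ℝ) ≤ n := by exact_mod_cast hn
  have hlam := lambdaMin_pos P Q hn
  have h1 : (maxDim dA : ℝ) * maxDim dB ≤ (lambdaMin P Q ^ 2)⁻¹ := by
    rw [le_inv_comm₀ (by linarith) (by positivity), ← one_div, le_div_iff₀ (by linarith)]
    exact lambdaMin_sq_mul_le_one P Q hn
  have h2 : (4 * ((maxDim dA : ℝ) * maxDim dB))⁻¹ ≤ (χmin ^ 2)⁻¹ := by
    refine inv_anti₀ (by positivity) ?_
    calc χmin ^ 2 ≤ (2 * √(maxDim dA * maxDim dB)) ^ 2 := by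
          gcongr
          exact h.le_sqrt hn
      _ = _ := by rw [mul_pow, Real.sq_sqrt (by positivity)]; norm_num
  have h3 : (1 : ℝ) / 2 ≤ Real.log (n * maxDim dA * maxDim dB / κ) := by
    have h4 : (2 : ℝ) ≤ n * maxDim dA * maxDim dB / κ := by
      rw [le_div_iff₀ hκ]
      nlinarith
    have := Real.log_le_log (by norm_num) h4
    linarith [Real.log_two_gt_d9]
  rw [queryBound]
  set D := (maxDim dA : ℝ) * maxDim dB with hDdef
  calc D ^ 4 / 8 = D ^ 4 * D * (4 * D)⁻¹ * (1 / 2) := by field_simp; norm_num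
    _ ≤ D ^ 4 * (lambdaMin P Q ^ 2)⁻¹ * (χmin ^ 2)⁻¹ *
        Real.log (n * maxDim dA * maxDim dB / κ) := by gcongr
    _ = _ := by rw [hDdef, mul_pow]

theorem theorem2 :
    ∃ c₁ c₂ c₃ : ℝ, 0 < c₁ ∧ 0 < c₂ ∧ 0 < c₃ ∧
      ∀ (n : ℕ) (dA dB : Fin n → ℕ) [∀ i, NeZero (dA i)] [∀ j, NeZero (dB j)]
        (P : ∀ i, ICPOVM (dA i)) (Q : ∀ j, ICPOVM (dB j))
        (C : Channel (Joint dA) (Joint dB)) (σ π : Equiv.Perm (Fin n)) (χmin κ : ℝ),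
        0 < n → 0 < χmin → 0 < κ → κ < 1 →
        IsComb C σ π → TotallyCorrelated C σ π χmin →
        -- the number of queries `⌈c₁ X⌉` is of the order of `X`
        (⌈c₁ * queryBound P Q χmin κ⌉₊ : ℝ) ≤ c₂ * queryBound P Q χmin κ ∧
        -- and this number, as well as any larger one, is enough
        ∀ N : ℕ, ⌈c₁ * queryBound P Q χmin κ⌉₊ ≤ N →
          ENNReal.ofReal (1 - κ) ≤
            ((discoverOrder P Q N χmin).run C).toOuterMeasure
              {r | r.value = List.ofFn fun k => (σ k, π k)} ∧
          ∀ r ∈ ((discoverOrder P Q N χmin).run C).support,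
            r.queries = N ∧
            (r.time : ℝ) ≤ c₃ * (N * n * (n + maxDim dA + (maxDim dB : ℝ) ^ 4)) := by
  -- `4096 = 4 · 4 · 16²`: the squared accuracy brings `16²`, the tail bound a denominator 4, and
  -- the exponent is to be four times the logarithm. As `X ≥ 1`, rounding up costs at most one
  -- further `X`. The third constant is that of `bounded_discoverOrder`.
  refine ⟨4096, 4097, 4000, by norm_num, by norm_num, by norm_num, ?_⟩
  intro n dA dB _ _ P Q C σ π χmin κ hn hχ hκ hκ1 _ h
  have hD2 := h.two_le hn hχ
  have hD : (2 : ℝ) ≤ maxDim dA * maxDim dB := by exact_mod_cast hD2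
  have hX := h.le_queryBound (P := P) (Q := Q) hn hχ hκ hκ1
  have hn1 : (1 : ℝ) ≤ n := by exact_mod_cast hn
  have hD4 : (16 : ℝ) ≤ ((maxDim dA : ℝ) * maxDim dB) ^ 4 := by
    calc (16 : ℝ) = 2 ^ 4 := by norm_num
      _ ≤ _ := by gcongr
  refine ⟨?_, fun N hN => ?_⟩
  · have := Nat.ceil_lt_add_one (a := 4096 * queryBound P Q χmin κ) (by linarith)
    linarith
  · have hN' : 4096 * queryBound P Q χmin κ ≤ N := Nat.ceil_le.mp hN
    have hND : (maxDim dA : ℝ) ^ 4 * maxDim dB ^ 4 ≤ N := by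
      rw [← mul_pow]
      linarith
    have hN0 : 0 < N := by
      have : (0 : ℝ) < N := by linarith
      exact_mod_cast this
    refine ⟨?_, fun r hr => ?_⟩
    · refine ENNReal.ofReal_le_of_le_toReal (le_trans ?_ (one_sub_le_discoverOrder hn hχ h hN0))
      have hlam := lambdaMin_pos P Q hn
      have hexp : 4 * Real.log (n * maxDim dA * maxDim dB / κ) ≤
          N * (lambdaMin P Q * χmin / (16 * (maxDim dA * maxDim dB) ^ 2)) ^ 2 / 4 := by
        calc _ = 4096 * queryBound P Q χmin κ *
              (lambdaMin P Q * χmin / (16 * (maxDim dA * maxDim dB) ^ 2)) ^ 2 / 4 := by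
              have hne : (maxDim dA : ℝ) * maxDim dB ≠ 0 := by linarith
              have hA := left_ne_zero_of_mul hne
              have hB := right_ne_zero_of_mul hne
              rw [queryBound]
              field_simp
              ring
          _ ≤ _ := by gcongr
      set D := (maxDim dA : ℝ) * maxDim dB with hDdef
      have hL : (0 : ℝ) < n * D / κ := by positivity
      have hexp2 : Real.exp (-(N * (lambdaMin P Q * χmin / (16 * D ^ 2)) ^ 2 / 4)) ≤
          ((n * D / κ) ^ 4)⁻¹ := by
        rw [← Real.exp_log (pow_pos hL 4), ← Real.exp_neg, Real.log_pow]
        rw [mul_assoc, ← hDdef] at hexp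
        exact Real.exp_le_exp.mpr (by push_cast; linarith)
      -- The exponent 4 turns the tail into `(κ / (n D))⁴`, which beats the `n² D²` events of the
      -- union bound: the rest, `2 κ³ / (n D)²`, is at most 1 because `n D ≥ 2`.
      have hfinal : (n : ℝ) ^ 2 * D ^ 2 * (2 * ((n * D / κ) ^ 4)⁻¹) ≤ κ := by
        have e : (n : ℝ) ^ 2 * D ^ 2 * (2 * ((n * D / κ) ^ 4)⁻¹) =
            κ * (2 * κ ^ 3 / (n * D) ^ 2) := by
          field_simp
        rw [e]
        refine mul_le_of_le_one_right hκ.le ?_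
        have hnD : 2 ≤ n * D := by nlinarith
        rw [div_le_one (by positivity)]
        have : κ ^ 3 ≤ 1 := pow_le_one₀ hκ.le hκ1.le
        nlinarith
      have hmul : (n : ℝ) ^ 2 * D ^ 2 *
          (2 * Real.exp (-(N * (lambdaMin P Q * χmin / (16 * D ^ 2)) ^ 2 / 4))) ≤ κ :=
        le_trans (by gcongr) hfinal
      linarith
    · have hA1 : 1 ≤ maxDim dA := Nat.pos_of_ne_zero fun h0 => by simp [h0] at hD2
      have hB1 : 1 ≤ maxDim dB := Nat.pos_of_ne_zero fun h0 => by simp [h0] at hD2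
      obtain ⟨ht, hq⟩ := bounded_discoverOrder (C := C) P Q N χmin (le_maxDim dA) (le_maxDim dB)
        hA1 hB1 hn (by exact_mod_cast hND) r hr
      exact ⟨hq, by exact_mod_cast ht⟩
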